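/- Conventions. Let $\Phi_{m,n}$ be the set of tuples $S=(s_1,\dots,s_m)$ of nonnegative integers with sum $n$. For a complex $m\times m$ matrix $U$, the $n$-photon transformation $\varphi(U)$ is given by $$\langle S|\varphi(U)|T\rangle=\frac{\operatorname{Per}(U_{S,T})}{\sqrt{s_1!\cdots s_m!\,t_1!\cdots t_m!}}\qquad(S,T\in\Phi_{m,n}),$$ where $U_{S,T}$ takes $s_i$ copies of row $i$ and $t_j$ copies of column $j$ of $U$. A linear-optics gate is a $2\times2$ unitary acting on two distinct modes and as the identity on the other modes (direct sum; one-mode gates $u\oplus1$ are included). A linear-optics circuit $L$ is a list of such gates on $m=2n$ modes, identified with the product of its gates; its initial state is $|I\rangle=|0,1,0,1,\dots,0,1\rangle$, with $n$ photons. A qubit circuit $Q$ is a list of gates from $\mathcal G$ = all one-qubit gates together with $\mathrm{CSIGN}=\mathrm{diag}(1,1,1,-1)$ on two distinct qubits. In strings that describe circuits, each one-qubit gate is given by a bit string, the interpretation of bit strings as $2\times2$ unitaries being arbitrary, and the numbers of qubits and modes and the indices of qubits and modes are written in unary. Let $\mathrm{NS}_1$ be the operation $\alpha_0|0\rangle+\alpha_1|1\rangle+\alpha_2|2\rangle\mapsto\alpha_0|0\rangle+\alpha_1|1\rangle-\alpha_2|2\rangle$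 on one mode, $H=\frac1{\sqrt2}\begin{pmatrix}1&1\\1&-1\end{pmatrix}$, and $$W=\begin{pmatrix}1-\sqrt2&\sqrt{\tfrac3{\sqrt2}-2}&2^{-1/4}\\ \sqrt{\tfrac3{\sqrt2}-2}&\sqrt2-\tfrac12&\tfrac12-\tfrac1{\sqrt2}\\2^{-1/4}&\tfrac12-\tfrac1{\sqrt2}&\tfrac12\end{pmatrix}.$$ Theorem. (a) $W$ is unitary. In any system of modes, apply $W$ to distinct modes $i,j,k$, where $i$ holds at most $2$ photons and $j,k$ start in $|0,1\rangle$, and postselect on $j,k$ being returned to $|0,1\rangle$. The effect is $\tfrac12\,\mathrm{NS}_1$ on mode $i$ and the identity on all other modes. (b) Let $p,q,a,b,c,d$ be distinct modes, where $p$ and $q$ hold at most one photon each and $(a,b)$, $(c,d)$ start in $|0,1\rangle$. Apply $H$ to $p,q$, then $W$ to $p,a,b$, then $W$ to $q,c,d$, then $H$ to $p,q$, and postselect on $(a,b)$ and $(c,d)$ being returned to $|0,1\rangle$. The effect is $\tfrac14$ times the map that changes the sign of a basis state exactly when $p$ and $q$ both hold a photon, and that is the identity otherwise. (c) There is a fixed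 finite sequence $w$ of two-mode gates on three modes with product $W$ such that the following conversion of a qubit circuit $Q$ over $\mathcal G$, with $k$ qubits and $\Gamma$ $\mathrm{CSIGN}$ gates, into a linear-optics circuit $L$ with $2k+4\Gamma$ modes is computed by a Turing machine in time polynomial in the length of the description of $Q$. Modes are numbered from $0$. Qubit $i\in\{0,\dots,k-1\}$ is dual-rail encoded in the modes $2i,2i+1$, with $|0\rangle$ as $|0,1\rangle$ and $|1\rangle$ as $|1,0\rangle$. A one-qubit gate is applied as a $2\times2$ unitary to the two modes of its qubit. The $g$-th $\mathrm{CSIGN}$ gate ($g=0,\dots,\Gamma-1$), on qubits $i,j$, is replaced by the sequence of (b) with $p=2i$, $q=2j$ and $(a,b,c,d)=(2k+4g,\,2k+4g+1,\,2k+4g+2,\,2k+4g+3)$, each $W$ being carried out by $w$. For all $Q$, and all interpretations of the descriptions of one-qubit gates, $$\langle I|\varphi(L)|I\rangle=\frac{\langle0\cdots0|Q|0\cdots0\rangle}{4^{\Gamma}}.$$ Moreover, on every dual-rail encoded input $|x\rangle$, $x\in\{0,1\}^k$, with the $4\Gamma$ ancilla modes starting in $|0,1,\dots,0,1\rangle$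 and postselected on that state, $L$ produces $4^{-\Gamma}$ times the dual-rail encoding of $Q|x\rangle$. -/

import Mathlib

noncomputable section

namespace KLM

open Matrix

/-! ### Qubit circuits over one-qubit gates and CSIGN -/

/-- A gate on `k` qubits: a one-qubit gate (named by a label `a`) on qubit `i`, or a CSIGN gate
on two distinct qubits `i`, `j`. -/
inductive QGate (A : Type) (k : ℕ) : Type
  | one (a : A) (i : Fin k)
  | csign (i j : Fin k) (hij : i ≠ j)

/-- A qubit circuit: the number of qubits, and the list of gates, the first one applied first. -/
structure QCircuit (A : Type) : Type where
  qubits : ℕ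
  gates : List (QGate A qubits)

/-- The matrix of a gate in the computational basis `|x⟩`, `x ∈ {0,1}^k` (row = output,
column = input), once a one-qubit unitary has been assigned to every label. -/
def QGate.matrix {A : Type} {k : ℕ} (ρ : A → unitaryGroup (Fin 2) ℂ) :
    QGate A k → Matrix (Fin k → Fin 2) (Fin k → Fin 2) ℂ
  | .one a i => Matrix.of fun y x =>
      if ∀ l, l ≠ i → y l = x l then (ρ a : Matrix (Fin 2) (Fin 2) ℂ) (y i) (x i) else 0
  | .csign i j _ => Matrix.diagonal fun x => if x i = 1 ∧ x j = 1 then -1 else 1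

/-- The unitary transformation induced by a qubit circuit. -/
def QCircuit.matrix {A : Type} (ρ : A → unitaryGroup (Fin 2) ℂ) (Q : QCircuit A) :
    Matrix (Fin Q.qubits → Fin 2) (Fin Q.qubits → Fin 2) ℂ :=
  Q.gates.foldl (fun M g => g.matrix ρ * M) 1

/-- The number of CSIGN gates in a list of gates. -/
def csignCount {A : Type} {k : ℕ} : List (QGate A k) → ℕ
  | [] => 0
  | .one _ _ :: gs => csignCount gs
  | .csign _ _ _ :: gs => csignCount gs + 1

/-- The number `Γ` of CSIGN gates in a circuit. -/
def QCircuit.numCSIGN {A : Type} (Q : QCircuit A) : ℕ := csignCount Q.gates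

/-! ### Linear optics -/

/-- The occupation numbers `(s₁, …, sₘ)` of `n` photons in `m` modes. -/
abbrev Occ (m n : ℕ) : Type := {s : Fin m → ℕ // ∑ i, s i = n}

/-- The nondecreasing list of modes of the `n` photons of `S`: each mode `i` is repeated
`sᵢ` times. -/
def Occ.modes {m n : ℕ} (S : Occ m n) (r : Fin n) : Fin m :=
  (finSigmaFinEquiv.symm (Fin.cast S.2.symm r)).1

/-- The `n`-photon transformation `φ(U)` induced by an `m × m` matrix `U`:
`⟨S|φ(U)|T⟩ = Per(U_{S,T}) / √(s₁! ⋯ sₘ! t₁! ⋯ tₘ!)`, where `U_{S,T}` takes `sᵢ` copies of row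
`i` and `tⱼ` copies of column `j`. -/
def fock {m : ℕ} (n : ℕ) (U : Matrix (Fin m) (Fin m) ℂ) : Matrix (Occ m n) (Occ m n) ℂ :=
  Matrix.of fun S T => (U.submatrix S.modes T.modes).permanent /
    (Real.sqrt ((∏ i, ((S.1 i).factorial : ℝ)) * ∏ j, ((T.1 j).factorial : ℝ)) : ℂ)

/-- For injective `e`, the direct sum of the matrix `U` on the modes `e 0, …, e (r-1)` and the
identity on all other modes. -/
def onModes {r m : ℕ} (e : Fin r → Fin m) (U : Matrix (Fin r) (Fin r) ℂ) :
    Matrix (Fin m) (Fin m) ℂ :=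
  Matrix.of fun a b => (∑ s, ∑ t, if e s = a ∧ e t = b then U s t else 0) +
    if a = b ∧ ∀ s, e s ≠ a then 1 else 0

/-- A linear-optics gate: a `2 × 2` unitary (named by a label) applied to two distinct modes.
A one-mode gate `u` is the two-mode gate `u ⊕ 1`. -/
structure LOGate (B : Type) (m : ℕ) : Type where
  label : B
  fst : Fin m
  snd : Fin m
  ne : fst ≠ snd

/-- The `m × m` unitary of a linear-optics gate. -/
def LOGate.matrix {B : Type} {m : ℕ} (ρ : B → unitaryGroup (Fin 2) ℂ) (g : LOGate B m) :
    Matrix (Fin m) (Fin m) ℂ :=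
  onModes ![g.fst, g.snd] (ρ g.label : Matrix (Fin 2) (Fin 2) ℂ)

/-- The `m × m` unitary of a list of linear-optics gates, the first one applied first. -/
def loMatrix {B : Type} {m : ℕ} (ρ : B → unitaryGroup (Fin 2) ℂ) (gs : List (LOGate B m)) :
    Matrix (Fin m) (Fin m) ℂ :=
  gs.foldl (fun M g => g.matrix ρ * M) 1

/-- A linear-optics circuit with `n` photons in `m = 2n` modes. -/
structure LOCircuit (B : Type) : Type where
  photons : ℕ
  gates : List (LOGate B (2 * photons))

/-- The `m × m` unitary of a linear-optics circuit. -/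
def LOCircuit.matrix {B : Type} (ρ : B → unitaryGroup (Fin 2) ℂ) (L : LOCircuit B) :
    Matrix (Fin (2 * L.photons)) (Fin (2 * L.photons)) ℂ :=
  loMatrix ρ L.gates

theorem sum_fin_two_mul (n : ℕ) (f : ℕ → ℕ) :
    ∑ p : Fin (2 * n), f p = ∑ i : Fin n, (f (2 * i) + f (2 * i + 1)) := by
  rw [Fin.sum_univ_eq_sum_range f, Fin.sum_univ_eq_sum_range (fun i => f (2 * i) + f (2 * i + 1))]
  induction n with
  | zero => simp
  | succ n ih => rw [Nat.mul_succ, Finset.sum_range_succ, Finset.sum_range_succ, ih,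
      Finset.sum_range_succ, add_assoc]

/-- The standard initial state `|I⟩ = |0,1,0,1,…,0,1⟩`. -/
def stdState (n : ℕ) : Occ (2 * n) n :=
  ⟨fun p => (p : ℕ) % 2, by
    rw [sum_fin_two_mul n (fun p => p % 2)]
    simp [Nat.add_mod]⟩

/-- The dual-rail encoding of the basis state `|x⟩` of `k` qubits, followed by `r` pairs of
ancilla modes in the state `|0,1⟩`. Qubit `i` lives on the modes `2i` and `2i+1`; its state `|0⟩`
is `|0,1⟩` and its state `|1⟩` is `|1,0⟩`. -/
def dualRail {k : ℕ} (r : ℕ) (x : Fin k → Fin 2) : Occ (2 * (k + r)) (k + r) :=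
  ⟨fun p => if h : (p : ℕ) / 2 < k then
      (if (p : ℕ) % 2 = 0 then (x ⟨p / 2, h⟩ : ℕ) else 1 - (x ⟨p / 2, h⟩ : ℕ))
    else (p : ℕ) % 2, by
    rw [sum_fin_two_mul (k + r) (fun p => if h : p / 2 < k then
      (if p % 2 = 0 then (x ⟨p / 2, h⟩ : ℕ) else 1 - (x ⟨p / 2, h⟩ : ℕ)) else p % 2)]
    have key : ∀ i : Fin (k + r),
        ((if h : (2 * (i : ℕ)) / 2 < k then (if (2 * (i : ℕ)) % 2 = 0
            then (x ⟨(2 * (i : ℕ)) / 2, h⟩ : ℕ) else 1 - (x ⟨(2 * (i : ℕ)) / 2, h⟩ : ℕ))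
          else (2 * (i : ℕ)) % 2) +
         (if h : (2 * (i : ℕ) + 1) / 2 < k then (if (2 * (i : ℕ) + 1) % 2 = 0
            then (x ⟨(2 * (i : ℕ) + 1) / 2, h⟩ : ℕ) else 1 - (x ⟨(2 * (i : ℕ) + 1) / 2, h⟩ : ℕ))
          else (2 * (i : ℕ) + 1) % 2)) = 1 := by
      intro i
      have h1 : 2 * (i : ℕ) / 2 = i := by omega
      have h2 : (2 * (i : ℕ) + 1) / 2 = i := by omega
      have h3 : 2 * (i : ℕ) % 2 = 0 := by omega
      have h4 : (2 * (i : ℕ) + 1) % 2 = 1 := by omega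
      simp only [h1, h2, h3, h4]
      by_cases h : (i : ℕ) < k
      · have hx := (x ⟨i, h⟩).isLt
        simp only [h, dite_true, if_true, one_ne_zero, if_false]
        omega
      · simp [h]
    rw [Finset.sum_congr rfl fun i _ => key i]
    simp⟩

/-! ### The gates of the construction -/

/-- The Hadamard matrix. -/
def hadamard : unitaryGroup (Fin 2) ℂ :=
  ⟨((1 / Real.sqrt 2 : ℝ) : ℂ) • !![1, 1; 1, -1], by
    have h : ((Real.sqrt 2 : ℝ) : ℂ)⁻¹ * ((Real.sqrt 2 : ℝ) : ℂ)⁻¹ = 1 / 2 := by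
      rw [← mul_inv, ← Complex.ofReal_mul, Real.mul_self_sqrt (by norm_num)]
      norm_num
    rw [mem_unitaryGroup_iff]
    ext i j
    fin_cases i <;> fin_cases j <;>
      simp [Matrix.mul_apply, Fin.sum_univ_two, Matrix.star_eq_conjTranspose, h] <;> norm_num⟩

/-- The `3 × 3` matrix `W` used to implement `NS₁`. -/
def W : Matrix (Fin 3) (Fin 3) ℂ :=
  (!![1 - √2, √(3 / √2 - 2), 1 / 2 ^ (1 / 4 : ℝ);
      √(3 / √2 - 2), √2 - 1 / 2, 1 / 2 - 1 / √2;
      1 / 2 ^ (1 / 4 : ℝ), 1 / 2 - 1 / √2, 1 / 2] : Matrix (Fin 3) (Fin 3) ℝ).map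
    (fun t : ℝ => (t : ℂ))

/-- `NS₁` multiplies `|s⟩` (`s ≤ 2` photons in a mode) by this sign. -/
def ns₁ (s : ℕ) : ℂ := if s = 2 then -1 else 1

/-! ### The construction -/

/-- The label of an output gate: either the description (a bit string) of a one-qubit gate of the
input circuit, or the Hadamard matrix, or one of `r` fixed two-mode gates. -/
inductive LOLabel (r : ℕ) : Type
  | given (d : List Bool)
  | hadamard
  | fixed (t : Fin r)

/-- The `2 × 2` unitary of a label, when the input descriptions are interpreted by `ρ` and the
fixed gates are those of the list `w`. -/
def LOLabel.unitary {m : ℕ} (w : List (LOGate (unitaryGroup (Fin 2) ℂ) m))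
    (ρ : List Bool → unitaryGroup (Fin 2) ℂ) : LOLabel w.length → unitaryGroup (Fin 2) ℂ
  | .given d => ρ d
  | .hadamard => KLM.hadamard
  | .fixed t => (w.get t).label

/-- The gates `w` on three modes, applied to the modes `e 0`, `e 1`, `e 2`. -/
def placeW (w : List (LOGate (unitaryGroup (Fin 2) ℂ) 3)) {m : ℕ} (e : Fin 3 ↪ Fin m) :
    List (LOGate (LOLabel w.length) m) :=
  List.ofFn fun t : Fin w.length =>
    ⟨.fixed t, e (w.get t).fst, e (w.get t).snd, e.injective.ne (w.get t).ne⟩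

/-- Three distinct modes, as an embedding. -/
def threeModes {m : ℕ} (a b c : Fin m) (hab : a ≠ b) (hac : a ≠ c) (hbc : b ≠ c) :
    Fin 3 ↪ Fin m :=
  ⟨![a, b, c], by
    intro s t h
    fin_cases s <;> fin_cases t <;> simp_all⟩

/-- Gate-by-gate translation into a linear-optics circuit with `2n` modes; `g` CSIGN gates have
been translated already. A one-qubit gate acts on the two modes of its qubit (`|0⟩` is a photon in
mode `2i+1`, `|1⟩` is a photon in mode `2i`). A CSIGN gate on qubits `i`, `j` becomes: Hadamard on
modes `2i`, `2j`; then `W` on mode `2i` and two fresh ancilla modes; then `W` on mode `2j` and two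
further fresh ancilla modes; then Hadamard on modes `2i`, `2j`. -/
def translateGates (w : List (LOGate (unitaryGroup (Fin 2) ℂ) 3)) {k : ℕ} (n : ℕ) :
    (g : ℕ) → (gs : List (QGate (List Bool) k)) → k + 2 * (g + csignCount gs) ≤ n →
      List (LOGate (LOLabel w.length) (2 * n))
  | _, [], _ => []
  | g, .one d i :: gs, h =>
      have hi := i.isLt
      have h' : k + 2 * (g + csignCount gs) ≤ n := by simpa [csignCount] using h
      ⟨.given d, ⟨2 * i + 1, by omega⟩, ⟨2 * i, by omega⟩, by simp⟩ :: translateGates w n g gs h'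
  | g, .csign i j hij :: gs, h =>
      have hi := i.isLt
      have hj := j.isLt
      have hne : (i : ℕ) ≠ j := fun e => hij (Fin.ext e)
      have h' : k + 2 * (g + (csignCount gs + 1)) ≤ n := by simpa [csignCount] using h
      [⟨.hadamard, ⟨2 * i, by omega⟩, ⟨2 * j, by omega⟩, by simp; omega⟩] ++
      placeW w (threeModes ⟨2 * i, by omega⟩ ⟨2 * k + 4 * g, by omega⟩ ⟨2 * k + 4 * g + 1, by omega⟩
        (by simp; omega) (by simp; omega) (by simp)) ++
      placeW w (threeModes ⟨2 * j, by omega⟩ ⟨2 * k + 4 * g + 2, by omega⟩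
        ⟨2 * k + 4 * g + 3, by omega⟩ (by simp; omega) (by simp; omega) (by simp)) ++
      [⟨.hadamard, ⟨2 * i, by omega⟩, ⟨2 * j, by omega⟩, by simp; omega⟩] ++
      translateGates w n (g + 1) gs (by omega)

/-- The linear-optics circuit of a qubit circuit with `k` qubits and `Γ` CSIGN gates: it has
`k + 2Γ` photons in `2k + 4Γ` modes. -/
def translate (w : List (LOGate (unitaryGroup (Fin 2) ℂ) 3)) (Q : QCircuit (List Bool)) :
    LOCircuit (LOLabel w.length) where
  photons := Q.qubits + 2 * Q.numCSIGN
  gates := translateGates w (Q.qubits + 2 * Q.numCSIGN) 0 Q.gates (by simp [QCircuit.numCSIGN])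

/-! ### Circuits as strings

Numbers of qubits and of modes, and the indices of qubits and modes, are written in unary, so that
polynomial in the length of a circuit means polynomial in the number of qubits (or modes), the
number of gates and the lengths of the gate descriptions. -/

/-- The alphabet for qubit circuits. -/
inductive QSym : Type
  | tick
  | sep
  | bit (b : Bool)
  | one
  | csign
  deriving DecidableEq, Fintype

/-- A gate as a string. -/
def QGate.encode {k : ℕ} : QGate (List Bool) k → List QSym
  | .one d i => [.one] ++ d.map .bit ++ List.replicate i .tick ++ [.sep]
  | .csign i j _ => [.csign] ++ List.replicate i .tick ++ [.sep] ++ List.replicate j .tick ++ [.sep]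

/-- A qubit circuit as a string. -/
def QCircuit.encode (Q : QCircuit (List Bool)) : List QSym :=
  List.replicate Q.qubits .tick ++ [.sep] ++ Q.gates.flatMap QGate.encode

/-- The alphabet for linear-optics circuits with `r` fixed gates. -/
inductive LOSym (r : ℕ) : Type
  | tick
  | sep
  | bit (b : Bool)
  | given
  | hadamard
  | fixed (t : Fin r)
  deriving DecidableEq, Fintype

/-- A label as a string. -/
def LOLabel.encode {r : ℕ} : LOLabel r → List (LOSym r)
  | .given d => [.given] ++ d.map .bit
  | .hadamard => [.hadamard]
  | .fixed t => [.fixed t]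

/-- A linear-optics gate as a string. -/
def LOGate.encode {r m : ℕ} (g : LOGate (LOLabel r) m) : List (LOSym r) :=
  g.label.encode ++ List.replicate g.fst .tick ++ [.sep] ++ List.replicate g.snd .tick ++ [.sep]

/-- A linear-optics circuit as a string. -/
def LOCircuit.encode {r : ℕ} (L : LOCircuit (LOLabel r)) : List (LOSym r) :=
  List.replicate (2 * L.photons) .tick ++ [.sep] ++ L.gates.flatMap LOGate.encode

theorem replicate_sep {α : Type} {t s : α} (hts : t ≠ s) {i j : ℕ} {l l' : List α}
    (h : List.replicate i t ++ s :: l = List.replicate j t ++ s :: l') : i = j ∧ l = l' := by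
  induction i generalizing j with
  | zero =>
    cases j with
    | zero => simpa using h
    | succ j => simp [List.replicate_succ, hts.symm] at h
  | succ i ih =>
    cases j with
    | zero => simp [List.replicate_succ, hts] at h
    | succ j =>
      simp only [List.replicate_succ, List.cons_append, List.cons.injEq, true_and] at h
      simpa using ih h

/-- Distinct qubit circuits have distinct strings. -/
theorem QCircuit.encode_injective : Function.Injective QCircuit.encode := by
  have bits : ∀ (d d' : List Bool) (i j : ℕ) (l l' : List QSym),
      d.map QSym.bit ++ (List.replicate i .tick ++ .sep :: l) =
        d'.map QSym.bit ++ (List.replicate j .tick ++ .sep :: l') → d = d' ∧ i = j ∧ l = l' := by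
    intro d
    induction d with
    | nil =>
      intro d' i j l l' h
      cases d' with
      | nil => exact ⟨rfl, replicate_sep (t := (.tick : QSym)) (s := .sep) (by simp) h⟩
      | cons b d' => cases i <;> simp [List.replicate_succ] at h
    | cons b d ih =>
      intro d' i j l l' h
      cases d' with
      | nil => cases j <;> simp [List.replicate_succ] at h
      | cons b' d' =>
        simp only [List.map_cons, List.cons_append, List.cons.injEq, QSym.bit.injEq] at h
        obtain ⟨h1, h2, h3⟩ := ih d' i j l l' h.2
        simp [h.1, h1, h2, h3]
  have gates : ∀ (k : ℕ) (gs gs' : List (QGate (List Bool) k)),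
      gs.flatMap QGate.encode = gs'.flatMap QGate.encode → gs = gs' := by
    intro k gs
    induction gs with
    | nil =>
      intro gs' h
      cases gs' with
      | nil => rfl
      | cons g gs' => cases g <;> simp [QGate.encode] at h
    | cons g gs ih =>
      intro gs' h
      cases gs' with
      | nil => cases g <;> simp [QGate.encode] at h
      | cons g' gs' =>
        cases g with
        | one d i =>
          cases g' with
          | one d' i' =>
            obtain ⟨h1, h2, h3⟩ := bits d d' i i' _ _ (by simpa [QGate.encode] using h)
            rw [h1, Fin.ext h2, ih _ h3]
          | csign i' j' _ => simp [QGate.encode] at h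
        | csign i j hij =>
          cases g' with
          | one d' i' => simp [QGate.encode] at h
          | csign i' j' hij' =>
            obtain ⟨h1, h2⟩ := replicate_sep (t := QSym.tick) (s := .sep) (by simp)
              (by simpa [QGate.encode] using h)
            obtain ⟨h3, h4⟩ := replicate_sep (by simp) h2
            obtain rfl := Fin.ext h1
            obtain rfl := Fin.ext h3
            rw [ih _ h4]
  rintro ⟨k, gs⟩ ⟨k', gs'⟩ h
  obtain ⟨rfl, h2⟩ := replicate_sep (t := QSym.tick) (s := .sep) (by simp)
    (by simpa [QCircuit.encode] using h)
  rw [gates _ _ _ h2]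

/-- Distinct linear-optics circuits have distinct strings. -/
theorem LOCircuit.encode_injective (r : ℕ) :
    Function.Injective (LOCircuit.encode : LOCircuit (LOLabel r) → List (LOSym r)) := by
  have bits : ∀ (d d' : List Bool) (i j : ℕ) (l l' : List (LOSym r)),
      d.map LOSym.bit ++ (List.replicate i .tick ++ .sep :: l) =
        d'.map LOSym.bit ++ (List.replicate j .tick ++ .sep :: l') → d = d' ∧ i = j ∧ l = l' := by
    intro d
    induction d with
    | nil =>
      intro d' i j l l' h
      cases d' with
      | nil => exact ⟨rfl, replicate_sep (t := (.tick : LOSym r)) (s := .sep) (by simp) h⟩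
      | cons b d' => cases i <;> simp [List.replicate_succ] at h
    | cons b d ih =>
      intro d' i j l l' h
      cases d' with
      | nil => cases j <;> simp [List.replicate_succ] at h
      | cons b' d' =>
        simp only [List.map_cons, List.cons_append, List.cons.injEq, LOSym.bit.injEq] at h
        obtain ⟨h1, h2, h3⟩ := ih d' i j l l' h.2
        simp [h.1, h1, h2, h3]
  have label : ∀ (a a' : LOLabel r) (i j : ℕ) (l l' : List (LOSym r)),
      a.encode ++ (List.replicate i .tick ++ .sep :: l) =
        a'.encode ++ (List.replicate j .tick ++ .sep :: l') → a = a' ∧ i = j ∧ l = l' := by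
    intro a a' i j l l' h
    cases a <;> cases a' <;> simp [LOLabel.encode] at h
    · obtain ⟨h1, h2⟩ := bits _ _ _ _ _ _ h
      exact ⟨by rw [h1], h2⟩
    · exact ⟨rfl, replicate_sep (by simp) h⟩
    · exact ⟨by rw [h.1], replicate_sep (by simp) h.2⟩
  have gates : ∀ (m : ℕ) (gs gs' : List (LOGate (LOLabel r) m)),
      gs.flatMap LOGate.encode = gs'.flatMap LOGate.encode → gs = gs' := by
    intro m gs
    induction gs with
    | nil =>
      intro gs' h
      cases gs' with
      | nil => rfl
      | cons g gs' => simp [LOGate.encode] at h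
    | cons g gs ih =>
      intro gs' h
      cases gs' with
      | nil => simp [LOGate.encode] at h
      | cons g' gs' =>
        obtain ⟨a, p, q, _⟩ := g
        obtain ⟨a', p', q', _⟩ := g'
        obtain ⟨h1, h2, h3⟩ := label a a' p p' _ _ (by simpa [LOGate.encode] using h)
        obtain ⟨h4, h5⟩ := replicate_sep (by simp) h3
        obtain rfl := Fin.ext h2
        obtain rfl := Fin.ext h4
        rw [h1, ih _ h5]
  rintro ⟨n, gs⟩ ⟨n', gs'⟩ h
  obtain ⟨h1, h2⟩ := replicate_sep (t := LOSym.tick) (s := .sep) (by simp)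
    (by simpa [LOCircuit.encode] using h)
  obtain rfl : n = n' := by omega
  rw [gates _ _ _ h2]

end KLM

end

/-! Photon states are treated as polynomials: occupation numbers T become the monomial X^T, and a
matrix U becomes the substitution `modeHom U`, X_j ↦ ∑ᵢ U_ij Xᵢ. By `permanent_submatrix_modes`,
Per(U_{S,T}) is ∏ sᵢ! times the coefficient of X^S in the image of X^T. Composing circuits is
composing substitutions (`modeHom_mul`), and after that lemma no permanent has to be expanded.

Postselection is a congruence. Modulo `offSector A α` only the monomials with the prescribed
exponents on A survive. A substitution that leaves the modes of A alone preserves this space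
(`FixesModes.modeHom_mem`), so every postselection can be postponed to the end of the circuit.

For W, the monomial Xᵢᵗ X_k goes to a product of t + 1 linear forms, and only its coefficient at Xᵢᵗ
X_k is visible in the sector. For t = 0, 1, 2 this is 1/2, 1/2, -1/2. For CSIGN
(`conj_signFlip_mem`), the Hadamard gate turns xy into (x² - y²)/2: two photons bunch in one mode,
exactly where NS₁ changes the sign. The constant and linear monomials see no sign, and the second
Hadamard gate undoes the first.

`translateGates_correct` combines the gates by induction. Each gadget has fresh ancilla modes that
later gates never touch, so the off-sector error of a gadget stays off sector. That W is a product
of two-mode gates follows by Givens elimination (`exists_loMatrix_eq`), without computing the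
factors.

The Turing machine reads its input once, keeps mode numbers in unary counters, and writes a fixed
template for each kind of gate. Counters are linearly bounded in the input length, so the time is
quadratic (`runs_program`). `gatesOutput_translationInstrs` identifies the written string with the
encoding of the translated circuit. -/

noncomputable section

namespace KLM

open Matrix MvPolynomial

/-! ### Sectors and untouched modes: postselection as a congruence -/

section Sector

variable {ι : Type*}

/-- Polynomials that vanish in the sector where each mode `a ∈ A` has occupation number `α a`. -/
def offSector (A : Set ι) (α : ι → ℕ) : Submodule ℂ (MvPolynomial ι ℂ) where
  carrier := {P | ∀ s : ι →₀ ℕ, (∀ a ∈ A, s a = α a) → coeff s P = 0}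
  add_mem' hP hQ s hs := by rw [coeff_add, hP s hs, hQ s hs, add_zero]
  zero_mem' s _ := by simp
  smul_mem' c P hP s hs := by rw [coeff_smul, hP s hs, smul_zero]

theorem offSector_mono {A B : Set ι} (h : A ⊆ B) (α : ι → ℕ) : offSector A α ≤ offSector B α :=
  fun _ hP s hs => hP s fun a ha => hs a (h ha)

theorem monomial_mem_offSector {A : Set ι} {α : ι → ℕ} {s : ι →₀ ℕ} {a : ι} (ha : a ∈ A)
    (hs : s a ≠ α a) (c : ℂ) : monomial s c ∈ offSector A α := by
  classical
  intro t ht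
  rw [coeff_monomial, if_neg]
  rintro rfl
  exact hs (ht a ha)

/-- The modes of `A` are not touched by `U`. -/
def FixesModes (U : Matrix ι ι ℂ) (A : Set ι) : Prop :=
  ∀ a ∈ A, ∀ l, l ≠ a → U a l = 0 ∧ U l a = 0

theorem FixesModes.one [DecidableEq ι] (A : Set ι) : FixesModes (1 : Matrix ι ι ℂ) A :=
  fun _ _ _ h => ⟨Matrix.one_apply_ne h.symm, Matrix.one_apply_ne h⟩

theorem FixesModes.mono {U : Matrix ι ι ℂ} {A B : Set ι} (h : FixesModes U B) (hAB : A ⊆ B) :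
    FixesModes U A := fun a ha => h a (hAB ha)

end Sector

/-! ### Matrices as linear substitutions -/

section Substitution

variable {ι : Type*} [Fintype ι]

/-- The linear substitution `X j ↦ ∑ i, U i j • X i`. -/
def modeHom (U : Matrix ι ι ℂ) : MvPolynomial ι ℂ →ₐ[ℂ] MvPolynomial ι ℂ :=
  aeval fun j => ∑ i, C (U i j) * X i

theorem modeHom_X (U : Matrix ι ι ℂ) (j : ι) : modeHom U (X j) = ∑ i, C (U i j) * X i := by
  simp [modeHom]

theorem modeHom_one [DecidableEq ι] (P : MvPolynomial ι ℂ) :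
    modeHom (1 : Matrix ι ι ℂ) P = P := by
  have : modeHom (1 : Matrix ι ι ℂ) = AlgHom.id ℂ _ := by
    ext1 j
    rw [modeHom_X, Finset.sum_eq_single j] <;> simp +contextual
  rw [this, AlgHom.id_apply]

theorem modeHom_mul (U V : Matrix ι ι ℂ) (P : MvPolynomial ι ℂ) :
    modeHom (U * V) P = modeHom U (modeHom V P) := by
  have : modeHom (U * V) = (modeHom U).comp (modeHom V) := by
    ext1 j
    simp only [AlgHom.comp_apply, modeHom_X, map_sum, map_mul, Matrix.mul_apply, algHom_C,
      Finset.sum_mul, Finset.mul_sum, algebraMap_eq]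
    rw [Finset.sum_comm]
    exact Finset.sum_congr rfl fun _ _ => Finset.sum_congr rfl fun _ _ => by ring
  rw [this, AlgHom.comp_apply]

/-- A linear substitution that only mixes modes of equal weight preserves the weight. -/
theorem isWeightedHomogeneous_modeHom {U : Matrix ι ι ℂ} {w : ι → ℕ}
    (hU : ∀ i j, U i j ≠ 0 → w i = w j) (s : ι →₀ ℕ) (c : ℂ) :
    IsWeightedHomogeneous w (modeHom U (monomial s c)) (Finsupp.weight w s) := by
  have hX : ∀ j, IsWeightedHomogeneous w (modeHom U (X j)) (w j) := by
    intro j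
    rw [modeHom_X]
    refine IsWeightedHomogeneous.sum _ _ _ fun i _ => ?_
    by_cases h : U i j = 0
    · simpa [h] using isWeightedHomogeneous_zero ℂ w (w j)
    · rw [← hU i j h]
      exact (isWeightedHomogeneous_X ℂ w i).C_mul _
  rw [monomial_eq, map_mul, algHom_C, algebraMap_eq, Finsupp.prod_fintype _ _ (by simp), map_prod,
    Finsupp.weight_apply, Finsupp.sum_fintype _ _ (by simp)]
  refine IsWeightedHomogeneous.C_mul (IsWeightedHomogeneous.prod _ _ _ fun j _ => ?_) _
  rw [map_pow]
  exact (hX j).pow _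

theorem FixesModes.mul {U V : Matrix ι ι ℂ} {A : Set ι} (hU : FixesModes U A)
    (hV : FixesModes V A) : FixesModes (U * V) A := by
  intro a ha l hl
  simp only [Matrix.mul_apply]
  constructor <;> refine Finset.sum_eq_zero fun j _ => ?_
  · by_cases h : j = a
    · rw [h, (hV a ha l hl).1, mul_zero]
    · rw [(hU a ha j h).1, zero_mul]
  · by_cases h : j = a
    · rw [h, (hU a ha l hl).2, zero_mul]
    · rw [(hV a ha j h).2, mul_zero]

/-- A monomial off the sector has a wrong exponent at some a ∈ A. Since U does not mix a with other
modes, the substitution preserves the degree in X_a, which is the weight `Pi.single a 1`; so the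
exponent stays wrong. -/
theorem FixesModes.modeHom_mem {U : Matrix ι ι ℂ} {A : Set ι} (hU : FixesModes U A) {α : ι → ℕ}
    {P : MvPolynomial ι ℂ} (hP : P ∈ offSector A α) : modeHom U P ∈ offSector A α := by
  classical
  rw [P.as_sum, map_sum]
  refine Submodule.sum_mem _ fun s hs t ht => ?_
  have : ∃ a ∈ A, s a ≠ α a := by
    by_contra! h
    exact (mem_support_iff.1 hs) (hP s h)
  obtain ⟨a, ha, hsa⟩ := this
  have hw := isWeightedHomogeneous_modeHom (U := U) (w := Pi.single a 1)
    (fun i j hij => by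
      by_cases hi : i = a <;> by_cases hj : j = a
      · rw [hi, hj]
      · exact absurd (hi ▸ (hU a ha j hj).1) hij
      · exact absurd (hj ▸ (hU a ha i hi).2) hij
      · simp [hi, hj]) s (coeff s P)
  refine hw.coeff_eq_zero t ?_
  simpa [Finsupp.weight_apply, Finsupp.sum_fintype, Pi.single_apply, ht a ha] using hsa.symm

end Substitution

/-! ### Permanents as coefficients of substituted monomials -/

section Fock

variable {m n : ℕ}

theorem Occ.prod_modes {M : Type*} [CommMonoid M] (S : Occ m n) (f : Fin m → M) :
    ∏ r, f (S.modes r) = ∏ i, f i ^ S.1 i := by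
  have h := Fintype.prod_equiv ((finCongr S.2.symm).trans finSigmaFinEquiv.symm)
    (fun r => f (S.modes r)) (fun x => f x.1) (fun r => rfl)
  rw [h, Fintype.prod_sigma]
  simp

theorem Occ.card_modes (S : Occ m n) (i : Fin m) : Fintype.card {r // S.modes r = i} = S.1 i := by
  -- In `Multiplicative ℕ` the product of the indicator of i over the photons is the number of
  -- photons in i.
  have h := S.prod_modes (M := Multiplicative ℕ) fun j => .ofAdd (if j = i then 1 else 0)
  rw [Fintype.card_subtype, Finset.card_filter]
  apply_fun Multiplicative.toAdd at h
  simpa using h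

/-- Occupation numbers as the exponents of a monomial. -/
def Occ.toFinsupp (S : Occ m n) : Fin m →₀ ℕ := Finsupp.equivFunOnFinite.symm S.1

@[simp]
theorem Occ.toFinsupp_apply (S : Occ m n) (i : Fin m) : S.toFinsupp i = S.1 i := rfl

theorem Occ.toFinsupp_inj {S T : Occ m n} : S.toFinsupp = T.toFinsupp ↔ S = T := by
  simp [Occ.toFinsupp, Subtype.ext_iff]

theorem sum_single_apply (f : Fin n → Fin m) (i : Fin m) :
    (∑ r, Finsupp.single (f r) 1 : Fin m →₀ ℕ) i = Fintype.card {r // f r = i} := by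
  rw [Fintype.card_subtype, Finset.card_filter, Finsupp.finsetSum_apply]
  simp only [Finsupp.single_apply]

theorem exists_perm_comp_eq {f g : Fin n → Fin m}
    (h : ∀ i, Fintype.card {r // f r = i} = Fintype.card {r // g r = i}) :
    ∃ τ : Equiv.Perm (Fin n), g ∘ τ = f := by
  have e : ∀ i, Nonempty ({r // f r = i} ≃ {r // g r = i}) := fun i =>
    Fintype.card_eq.1 (h i)
  refine ⟨(Equiv.sigmaFiberEquiv f).symm.trans ((Equiv.sigmaCongrRight fun i => (e i).some).trans
    (Equiv.sigmaFiberEquiv g)), funext fun r => ?_⟩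
  exact ((e (f r)).some ⟨r, rfl⟩).2

/-- If f has content S then f = S.modes ∘ τ for some τ, and the permutations σ in question form a
coset of the stabilizer of S.modes, whose order is ∏ sᵢ!. For any other content there are none. -/
theorem Occ.card_perm_comp_modes (S : Occ m n) (f : Fin n → Fin m) :
    Fintype.card {σ : Equiv.Perm (Fin n) // S.modes ∘ σ = f} =
      if ∑ r, Finsupp.single (f r) 1 = S.toFinsupp then ∏ i, (S.1 i).factorial else 0 := by
  classical
  split_ifs with h
  · obtain ⟨τ, rfl⟩ : ∃ τ : Equiv.Perm (Fin n), S.modes ∘ τ = f := by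
      refine exists_perm_comp_eq fun i => ?_
      rw [← sum_single_apply, h, S.card_modes, S.toFinsupp_apply]
    rw [← Finset.prod_congr rfl fun i _ => congrArg Nat.factorial (S.card_modes i),
      ← DomMulAct.stabilizer_card S.modes]
    refine Fintype.card_congr ((Equiv.mulRight τ⁻¹).subtypeEquiv fun σ => ?_)
    simp only [Equiv.coe_mulRight, Equiv.Perm.coe_mul, ← Function.comp_assoc]
    constructor
    · intro h
      rw [h, Function.comp_assoc]
      ext r
      simp
    · intro h
      nth_rewrite 2 [← h]
      ext r
      simp
  · rw [Fintype.card_eq_zero_iff]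
    refine ⟨fun ⟨σ, hσ⟩ => h ?_⟩
    ext i
    rw [sum_single_apply, S.toFinsupp_apply, ← S.card_modes, ← hσ]
    exact Fintype.card_congr (σ.subtypeEquiv fun r => Iff.rfl)

theorem Occ.monomial_eq_prod (T : Occ m n) :
    monomial T.toFinsupp (1 : ℂ) = ∏ r, X (T.modes r) := by
  rw [T.prod_modes, monomial_eq, Finsupp.prod_fintype _ _ (by simp)]
  simp

/-- Expanding the image of X^T gives a sum over all maps f from photons to modes. The permanent is a
sum over permutations σ; grouping them by f = S.modes ∘ σ, each f of content S occurs ∏ sᵢ! times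
and no other f occurs. -/
theorem permanent_submatrix_modes (U : Matrix (Fin m) (Fin m) ℂ) (S T : Occ m n) :
    (U.submatrix S.modes T.modes).permanent =
      (∏ i, ((S.1 i).factorial : ℂ)) *
        coeff S.toFinsupp (modeHom U (monomial T.toFinsupp 1)) := by
  classical
  have h1 : modeHom U (monomial T.toFinsupp 1) = ∑ f : Fin n → Fin m,
      monomial (∑ r, Finsupp.single (f r) 1) (∏ r, U (f r) (T.modes r)) := by
    rw [T.monomial_eq_prod, map_prod]
    simp only [modeHom_X, Finset.prod_univ_sum, Fintype.piFinset_univ]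
    refine Finset.sum_congr rfl fun f _ => ?_
    rw [monomial_sum_index]
    simp only [X, C_mul_monomial, mul_one]
    simp only [monomial_eq, Finset.prod_mul_distrib, ← map_prod]
    simp
  rw [h1, coeff_sum, Finset.mul_sum, Matrix.permanent,
    ← Finset.sum_fiberwise_of_maps_to (t := Finset.univ)
      (g := fun σ : Equiv.Perm (Fin n) => S.modes ∘ σ) (fun _ _ => Finset.mem_univ _)]
  refine Finset.sum_congr rfl fun f _ => ?_
  rw [Finset.sum_congr rfl (g := fun _ => ∏ r, U (f r) (T.modes r))]
  · rw [Finset.sum_const, ← Fintype.card_subtype, S.card_perm_comp_modes, coeff_monomial]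
    split_ifs <;> simp
  · intro σ hσ
    rw [← (Finset.mem_filter.1 hσ).2]
    rfl

theorem fock_apply (U : Matrix (Fin m) (Fin m) ℂ) (S T : Occ m n) :
    fock n U S T = (∏ i, ((S.1 i).factorial : ℂ)) *
        coeff S.toFinsupp (modeHom U (monomial T.toFinsupp 1)) /
      (Real.sqrt ((∏ i, ((S.1 i).factorial : ℝ)) * ∏ j, ((T.1 j).factorial : ℝ)) : ℂ) := by
  rw [← permanent_submatrix_modes]
  rfl

/-- If `U` sends the basis state `T` to `c • T` within a sector, then `c` is the only matrix
element of column `T` of the Fock transformation in the rows of that sector. -/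
theorem fock_eq_ite {U : Matrix (Fin m) (Fin m) ℂ} {S T : Occ m n} {A : Set (Fin m)}
    {α : Fin m → ℕ} {c : ℂ} (hS : ∀ a ∈ A, S.1 a = α a)
    (h : modeHom U (monomial T.toFinsupp 1) - c • monomial T.toFinsupp 1 ∈ offSector A α) :
    fock n U S T = if S = T then c else 0 := by
  have h' := h S.toFinsupp hS
  rw [coeff_sub, sub_eq_zero, coeff_smul, coeff_monomial] at h'
  simp only [Occ.toFinsupp_inj] at h'
  rw [fock_apply, h']
  split_ifs with hST hST' hST'
  · subst hST
    have h0 : (∏ i, ((T.1 i).factorial : ℝ)) ≠ 0 :=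
      Finset.prod_ne_zero_iff.2 fun i _ => by positivity
    -- On the diagonal the normalization is √((∏ tᵢ!)²), which cancels the factorials in front of
    -- the coefficient.
    rw [Real.sqrt_mul_self (Finset.prod_nonneg fun i _ => by positivity)]
    have h0' : (∏ i, ((T.1 i).factorial : ℂ)) ≠ 0 := by exact_mod_cast h0
    push_cast
    field_simp
    simp
  · exact absurd hST.symm hST'
  · exact absurd hST'.symm hST
  · simp

end Fock

/-! ### The matrix `W` -/

/-- With s = √2 and b = 2^(-1/4) all entries are polynomials in s and b, since (b(s - 1))² = (s/2)(3
- 2s) = 3s/2 - 2. The two relations on s and b then reduce every identity about W to algebra. -/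
theorem W_eq : ∃ s b : ℝ, s ^ 2 = 2 ∧ b ^ 2 = s / 2 ∧
    W = (!![1 - s, b * (s - 1), b; b * (s - 1), s - 1 / 2, (1 - s) / 2; b, (1 - s) / 2, 1 / 2] :
      Matrix (Fin 3) (Fin 3) ℝ).map (fun t : ℝ => (t : ℂ)) := by
  have hs : √2 ^ 2 = (2 : ℝ) := Real.sq_sqrt (by norm_num)
  have hs1 : 1 < √2 := by
    rw [Real.lt_sqrt] <;> norm_num
  have hs0 : √2 ≠ (0 : ℝ) := by positivity
  have hi : 1 / √2 = √2 / 2 := by field_simp; linarith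
  have hb : (1 / 2 ^ (1 / 4 : ℝ) : ℝ) ^ 2 = √2 / 2 := by
    rw [div_pow, one_pow, ← Real.rpow_natCast, ← Real.rpow_mul (by norm_num), ← hi,
      Real.sqrt_eq_rpow]
    norm_num
  have ha : √(3 / √2 - 2) = (1 / 2 ^ (1 / 4 : ℝ) : ℝ) * (√2 - 1) := by
    have h0 : (0 : ℝ) ≤ (1 / 2 ^ (1 / 4 : ℝ) : ℝ) * (√2 - 1) :=
      mul_nonneg (by positivity) (by linarith)
    rw [Real.sqrt_eq_iff_mul_self_eq_of_pos
      (mul_pos (by positivity) (by linarith)), ← sq, mul_pow, hb,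
      show 3 / √2 = 3 * (1 / √2) by ring, hi]
    nlinarith
  refine ⟨√2, 1 / 2 ^ (1 / 4 : ℝ), hs, hb, ?_⟩
  rw [W, ha, hi, show 1 / 2 - √2 / 2 = (1 - √2) / 2 by ring]

theorem W_mem_unitaryGroup : W ∈ unitaryGroup (Fin 3) ℂ := by
  obtain ⟨s, b, hs, hb, hW⟩ := W_eq
  rw [mem_unitaryGroup_iff, hW]
  have hs' : (s : ℂ) ^ 2 = 2 := by exact_mod_cast hs
  have hb' : (b : ℂ) ^ 2 = s / 2 := by exact_mod_cast congrArg (fun t : ℝ => (t : ℂ)) hb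
  ext i j
  fin_cases i <;> fin_cases j <;>
    simp [Matrix.mul_apply, Fin.sum_univ_three, Matrix.star_eq_conjTranspose] <;> grind

theorem W_apply_two_two : W 2 2 = 1 / 2 := by
  simp [W]

/-- The left side is the coefficient of Xᵢ X_k in (W₀₀ Xᵢ + W₂₀ X_k)(W₀₂ Xᵢ + W₂₂ X_k), where i, j,
k are the modes 0, 1, 2 of W. The next lemma is the analogue for Xᵢ² X_k. -/
theorem W_amplitude_one : W 0 0 * W 2 2 + W 2 0 * W 0 2 = 1 / 2 := by
  obtain ⟨s, b, hs, hb, hW⟩ := W_eq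
  have hb' : (b : ℂ) ^ 2 = s / 2 := by exact_mod_cast congrArg (fun t : ℝ => (t : ℂ)) hb
  simp [hW]
  grind

theorem W_amplitude_two : W 0 0 ^ 2 * W 2 2 + 2 * W 0 0 * W 2 0 * W 0 2 = -(1 / 2) := by
  obtain ⟨s, b, hs, hb, hW⟩ := W_eq
  have hs' : (s : ℂ) ^ 2 = 2 := by exact_mod_cast hs
  have hb' : (b : ℂ) ^ 2 = s / 2 := by exact_mod_cast congrArg (fun t : ℝ => (t : ℂ)) hb
  simp [hW]
  grind

/-! ### Matrices on some of the modes -/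

section OnModes

variable {r m : ℕ} {e : Fin r → Fin m}

theorem onModes_apply_apply (he : Function.Injective e) (U : Matrix (Fin r) (Fin r) ℂ)
    (s t : Fin r) : onModes e U (e s) (e t) = U s t := by
  simp only [onModes, Matrix.of_apply, he.eq_iff]
  rw [Finset.sum_eq_single s, Finset.sum_eq_single t]
  · simp
  · simp +contextual
  · simp
  · simp +contextual
  · simp

theorem onModes_apply_of_notMem_left {U : Matrix (Fin r) (Fin r) ℂ} {a : Fin m}
    (ha : ∀ s, e s ≠ a) (b : Fin m) : onModes e U a b = if a = b then 1 else 0 := by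
  simp [onModes, ha]

theorem onModes_apply_of_notMem_right {U : Matrix (Fin r) (Fin r) ℂ} {b : Fin m}
    (hb : ∀ s, e s ≠ b) (a : Fin m) : onModes e U a b = if a = b then 1 else 0 := by
  by_cases h : a = b
  · subst h
    simp [onModes, hb]
  · simp [onModes, hb, h]

theorem modeHom_onModes_apply (he : Function.Injective e) (U : Matrix (Fin r) (Fin r) ℂ)
    (t : Fin r) : modeHom (onModes e U) (X (e t)) = ∑ s, C (U s t) * X (e s) := by
  classical
  rw [modeHom_X, ← Finset.sum_subset (Finset.subset_univ (Finset.univ.image e)),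
    Finset.sum_image he.injOn]
  · simp only [onModes_apply_apply he]
  · intro a _ ha
    have ha' : ∀ s, e s ≠ a := by simpa using ha
    rw [onModes_apply_of_notMem_left ha', if_neg (ha' t).symm, C_0, zero_mul]

theorem modeHom_onModes_of_notMem {U : Matrix (Fin r) (Fin r) ℂ} {l : Fin m}
    (hl : ∀ s, e s ≠ l) : modeHom (onModes e U) (X l) = X l := by
  simp [modeHom_X, onModes_apply_of_notMem_right hl]

theorem fixesModes_onModes {U : Matrix (Fin r) (Fin r) ℂ} {A : Set (Fin m)}
    (hA : ∀ s, e s ∉ A) : FixesModes (onModes e U) A := by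
  intro a ha l hl
  have h : ∀ s, e s ≠ a := fun s hs => hA s (hs ▸ ha)
  rw [onModes_apply_of_notMem_left h, onModes_apply_of_notMem_right h, if_neg hl.symm, if_neg hl]
  exact ⟨rfl, rfl⟩

theorem modeHom_onModes_monomial {U : Matrix (Fin r) (Fin r) ℂ} {M : Fin m →₀ ℕ}
    (hM : ∀ s, M (e s) = 0) : modeHom (onModes e U) (monomial M 1) = monomial M 1 := by
  rw [monomial_eq, C_1, one_mul, Finsupp.prod_fintype _ _ (by simp), map_prod]
  refine Finset.prod_congr rfl fun l _ => ?_
  by_cases hl : ∃ s, e s = l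
  · obtain ⟨s, rfl⟩ := hl
    simp [hM]
  · rw [map_pow, modeHom_onModes_of_notMem fun s hs => hl ⟨s, hs⟩]

end OnModes

/-! ### The gadgets as substitutions -/

section Gadgets

variable {m : ℕ}

theorem monomial_split (T : Fin m →₀ ℕ) (i : Fin m) :
    (monomial T 1 : MvPolynomial (Fin m) ℂ) = X i ^ T i * monomial (T.erase i) 1 := by
  rw [X_pow_eq_monomial, monomial_mul, one_mul, Finsupp.single_add_erase]

theorem X_mul_mem_offSector {A : Set (Fin m)} {α : Fin m → ℕ} {j : Fin m} (hj : j ∈ A)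
    (hα : α j = 0) (P : MvPolynomial (Fin m) ℂ) : X j * P ∈ offSector A α := by
  intro s hs
  rw [coeff_X_mul', if_neg]
  simp [hs j hj, hα]

theorem X_sq_mul_mem_offSector {A : Set (Fin m)} {α : Fin m → ℕ} {k : Fin m} (hk : k ∈ A)
    (hα : α k = 1) (P : MvPolynomial (Fin m) ℂ) : X k ^ 2 * P ∈ offSector A α := by
  intro s hs
  rw [X_pow_eq_monomial, coeff_monomial_mul', if_neg]
  intro h
  have := h k
  simp [hs k hk, hα] at this

/-- `W` with two ancilla modes acts as `1/2 • NS₁`. -/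
theorem modeHom_onModes_W {i j k : Fin m} (he : Function.Injective ![i, j, k])
    {T : Fin m →₀ ℕ} (hi : T i ≤ 2) (hj : T j = 0) (hk : T k = 1) {A : Set (Fin m)}
    {α : Fin m → ℕ} (hjA : j ∈ A) (hkA : k ∈ A) (hαj : α j = 0) (hαk : α k = 1) :
    modeHom (onModes ![i, j, k] W) (monomial T 1) - (1 / 2 * ns₁ (T i)) • monomial T 1 ∈
      offSector A α := by
  have hij : i ≠ j := fun h => absurd (@he 0 1 h) (by decide)
  have hik : i ≠ k := fun h => absurd (@he 0 2 h) (by decide)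
  have hjk : j ≠ k := fun h => absurd (@he 1 2 h) (by decide)
  have hT := monomial_split T k
  rw [monomial_split (T.erase k) i, Finsupp.erase_ne hik, hk, pow_one] at hT
  set M := (T.erase k).erase i with hM
  have hMi : M i = 0 := Finsupp.erase_same
  have hMk : M k = 0 := by rw [hM, Finsupp.erase_ne hik.symm, Finsupp.erase_same]
  have hMj : M j = 0 := by rw [hM, Finsupp.erase_ne hij.symm, Finsupp.erase_ne hjk, hj]
  have hXi := modeHom_onModes_apply he W 0
  have hXk := modeHom_onModes_apply he W 2
  have hXM : modeHom (onModes ![i, j, k] W) (monomial M 1) = monomial M 1 :=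
    modeHom_onModes_monomial (by simp [Fin.forall_fin_succ, hMi, hMj, hMk])
  simp only [Fin.sum_univ_three, Matrix.cons_val] at hXi hXk
  -- These terms leave mode k empty, while the sector asks for one photon there.
  have bad : ∀ s, X i ^ s * monomial M (1 : ℂ) ∈ offSector A α := by
    intro s
    rw [X_pow_eq_monomial, monomial_mul]
    refine monomial_mem_offSector hkA ?_ _
    simp [hMk, hαk, hik]
  rw [hT, map_mul, map_mul, map_pow, hXi, hXk, hXM, smul_eq_C_mul]
  have h1 := W_apply_two_two
  have h2 := W_amplitude_one
  have h3 := W_amplitude_two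
  generalize monomial M (1 : ℂ) = Q at *
  generalize (W 0 0) = a at *
  generalize (W 1 0) = b at *
  generalize (W 2 0) = c at *
  generalize (W 0 2) = d at *
  generalize (W 1 2) = f at *
  generalize (W 2 2) = g at *
  -- What remains after subtracting the visible term splits into three kinds, all off sector: every
  -- photon of i and k in mode i (so s is T i + 1), some photon in j, or at least two in k.
  have close : ∀ (s : ℕ) (γ : ℂ) (P P' : MvPolynomial (Fin m) ℂ) {R : MvPolynomial (Fin m) ℂ},
      R = C γ * (X i ^ s * Q) + X j * P + X k ^ 2 * P' → R ∈ offSector A α := by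
    rintro s γ P P' R rfl
    refine add_mem (add_mem ?_ (X_mul_mem_offSector hjA hαj _)) (X_sq_mul_mem_offSector hkA hαk _)
    rw [← smul_eq_C_mul]
    exact Submodule.smul_mem _ _ (bad s)
  have hcases : T i = 0 ∨ T i = 1 ∨ T i = 2 := by omega
  rcases hcases with h | h | h <;> rw [h]
  · refine close 1 d (C f * Q) 0 ?_
    have : C (1 / 2 * ns₁ 0) = (C g : MvPolynomial (Fin m) ℂ) := by rw [h1]; simp [ns₁]
    rw [this]
    ring
  · refine close 2 (a * d) (C b * (C d * X i + C f * X j + C g * X k) * Q +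
      C f * (C a * X i + C c * X k) * Q) (C c * C g * Q) ?_
    have : C (1 / 2 * ns₁ 1) = (C (a * g + c * d) : MvPolynomial (Fin m) ℂ) := by
      rw [h2]; simp [ns₁]
    rw [this]
    simp only [map_add, map_mul]
    ring
  · refine close 3 (a ^ 2 * d) ((2 * C b * (C a * X i + C c * X k) + C b ^ 2 * X j) *
      (C d * X i + C f * X j + C g * X k) * Q + C f * (C a * X i + C c * X k) ^ 2 * Q)
      (((C c) ^ 2 * (C d * X i + C g * X k) + 2 * C a * C c * C g * X i) * Q) ?_
    have : C (1 / 2 * ns₁ 2) = (C (a ^ 2 * g + 2 * a * c * d) : MvPolynomial (Fin m) ℂ) := by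
      rw [h3]; simp [ns₁]
    rw [this]
    simp only [map_add, map_mul, map_pow, map_ofNat]
    ring

/-- The number h is 1/√2, but only h² = 1/2 is needed later, so no square root enters the polynomial
algebra. -/
theorem exists_modeHom_hadamard {p q : Fin m} (hpq : p ≠ q) : ∃ h : ℂ, h ^ 2 = 1 / 2 ∧
    modeHom (onModes ![p, q] (hadamard : Matrix (Fin 2) (Fin 2) ℂ)) (X p) = C h * (X p + X q) ∧
    modeHom (onModes ![p, q] (hadamard : Matrix (Fin 2) (Fin 2) ℂ)) (X q) = C h * (X p - X q) := by
  have heH : Function.Injective ![p, q] := by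
    intro s t h
    fin_cases s <;> fin_cases t <;> simp_all
  refine ⟨((1 / √2 : ℝ) : ℂ), ?_, ?_, ?_⟩
  · rw [← Complex.ofReal_pow, div_pow, Real.sq_sqrt] <;> norm_num
  · have := modeHom_onModes_apply heH (hadamard : Matrix (Fin 2) (Fin 2) ℂ) 0
    simp only [Fin.sum_univ_two, Matrix.cons_val] at this
    rw [this]
    simp [hadamard, mul_add]
  · have := modeHom_onModes_apply heH (hadamard : Matrix (Fin 2) (Fin 2) ℂ) 1
    simp only [Fin.sum_univ_two, Matrix.cons_val] at this
    rw [this]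
    simp [hadamard]
    ring

/-- The second W does not touch a and b, so the error of the first one stays off sector and the two
amplitudes multiply. The exponents go up to 2, as both photons can leave the Hadamard gate in the
same mode. -/
theorem modeHom_onModes_W_W {p q a b c d : Fin m} (he : Function.Injective ![p, q, a, b, c, d])
    {N : Fin m →₀ ℕ} (hNp : N p = 0) (hNq : N q = 0) (ha : N a = 0) (hb : N b = 1) (hc : N c = 0)
    (hd : N d = 1) {α : Fin m → ℕ} (hαa : α a = 0) (hαb : α b = 1) (hαc : α c = 0)
    (hαd : α d = 1) {s t : ℕ} (hs : s ≤ 2) (ht : t ≤ 2) :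
    modeHom (onModes ![q, c, d] W) (modeHom (onModes ![p, a, b] W)
        (X p ^ s * X q ^ t * monomial N 1)) -
      (1 / 4 * (ns₁ s * ns₁ t)) • (X p ^ s * X q ^ t * monomial N 1) ∈
      offSector {a, b, c, d} α := by
  have hpq : p ≠ q := fun h => absurd (@he 0 1 h) (by decide)
  have hpa : p ≠ a := fun h => absurd (@he 0 2 h) (by decide)
  have hpb : p ≠ b := fun h => absurd (@he 0 3 h) (by decide)
  have hpc : p ≠ c := fun h => absurd (@he 0 4 h) (by decide)
  have hpd : p ≠ d := fun h => absurd (@he 0 5 h) (by decide)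
  have hqa : q ≠ a := fun h => absurd (@he 1 2 h) (by decide)
  have hqb : q ≠ b := fun h => absurd (@he 1 3 h) (by decide)
  have hqc : q ≠ c := fun h => absurd (@he 1 4 h) (by decide)
  have hqd : q ≠ d := fun h => absurd (@he 1 5 h) (by decide)
  have hac : a ≠ c := fun h => absurd (@he 2 4 h) (by decide)
  have had : a ≠ d := fun h => absurd (@he 2 5 h) (by decide)
  have hbc : b ≠ c := fun h => absurd (@he 3 4 h) (by decide)
  have hbd : b ≠ d := fun h => absurd (@he 3 5 h) (by decide)
  have he1 : Function.Injective ![p, a, b] := by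
    convert he.comp (show Function.Injective ![(0 : Fin 6), 2, 3] by decide) using 1
    ext s; fin_cases s <;> rfl
  have he2 : Function.Injective ![q, c, d] := by
    convert he.comp (show Function.Injective ![(1 : Fin 6), 4, 5] by decide) using 1
    ext s; fin_cases s <;> rfl
  have hmon : X p ^ s * X q ^ t * monomial N 1 =
      monomial (Finsupp.single p s + Finsupp.single q t + N) (1 : ℂ) := by
    rw [X_pow_eq_monomial, X_pow_eq_monomial, monomial_mul, monomial_mul, one_mul, one_mul]
  have hv : (Finsupp.single p s + Finsupp.single q t + N) p = s := by simp [hNp, hpq]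
  have hv' : (Finsupp.single p s + Finsupp.single q t + N) q = t := by simp [hNq, hpq]
  have h1 := modeHom_onModes_W he1 (T := Finsupp.single p s + Finsupp.single q t + N)
      (A := {a, b}) (α := α) (by rw [hv]; exact hs) (by simp [hpa, hqa, ha])
      (by simp [hpb, hqb, hb]) (by simp) (by simp) hαa hαb
  have h2 := modeHom_onModes_W he2 (T := Finsupp.single p s + Finsupp.single q t + N)
      (A := {a, b, c, d}) (α := α) (by rw [hv']; exact ht) (by simp [hpc, hqc, hc])
      (by simp [hpd, hqd, hd]) (by simp) (by simp) hαc hαd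
  rw [hv, ← hmon] at h1
  rw [hv', ← hmon] at h2
  have hfix : FixesModes (onModes ![q, c, d] W) {a, b} := fixesModes_onModes (by
    simp [Fin.forall_fin_succ, hqa, hqb, hac.symm, had.symm, hbc.symm, hbd.symm])
  have := hfix.modeHom_mem h1
  have := add_mem (offSector_mono (B := {a, b, c, d}) (by intro x; simp; tauto) α this)
    (Submodule.smul_mem _ (1 / 2 * ns₁ s) h2)
  rw [map_sub, map_smul, smul_sub, sub_add_sub_cancel, smul_smul] at this
  convert this using 3
  ring

/-- Conjugating conditional sign flips `x² ↦ -x²`, `y² ↦ -y²` with a beam splitter gives a sign flip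
of `x y`. -/
theorem conj_signFlip_mem {R : Type*} [CommRing R] [Algebra ℂ R] {F G : R →ₐ[ℂ] R}
    {B : Submodule ℂ R} (hB : ∀ P ∈ B, F P ∈ B) {x y Q : R} {h : ℂ} (hh : h ^ 2 = 1 / 2)
    (hx : F x = algebraMap ℂ R h * (x + y)) (hy : F y = algebraMap ℂ R h * (x - y)) (hQ : F Q = Q)
    (hG : ∀ s t, s ≤ 2 → t ≤ 2 →
      G (x ^ s * y ^ t * Q) - (1 / 4 * (ns₁ s * ns₁ t)) • (x ^ s * y ^ t * Q) ∈ B)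
    {s t : ℕ} (hs : s ≤ 1) (ht : t ≤ 1) :
    F (G (F (x ^ s * y ^ t * Q))) -
      (1 / 4 * (if s = 1 ∧ t = 1 then -1 else 1) : ℂ) • (x ^ s * y ^ t * Q) ∈ B := by
  -- In each case below, P' is F P written out; G acts on it as the scalar c modulo B, and F takes
  -- it back to P.
  have key : ∀ {P P' : R} {c : ℂ}, G (F P) - c • P' ∈ B → F P' = P → F (G (F P)) - c • P ∈ B := by
    intro P P' c h1 h2
    have := hB _ h1
    rwa [map_sub, map_smul, h2] at this
  have hC : algebraMap ℂ R h ^ 2 = algebraMap ℂ R (1 / 2) := by rw [← map_pow, hh]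
  have hC2 : (2 : R) * algebraMap ℂ R (1 / 2) = 1 := by
    rw [← map_ofNat (algebraMap ℂ R) 2, ← map_mul]
    norm_num
  have hns : ns₁ 0 = 1 ∧ ns₁ 1 = 1 ∧ ns₁ 2 = -1 := by simp [ns₁]
  have h00 := hG 0 0 (by norm_num) (by norm_num)
  have h10 := hG 1 0 (by norm_num) (by norm_num)
  have h01 := hG 0 1 (by norm_num) (by norm_num)
  have h20 := hG 2 0 (by norm_num) (by norm_num)
  have h02 := hG 0 2 (by norm_num) (by norm_num)
  simp only [hns, pow_zero, pow_one, one_mul, mul_one] at h00 h10 h01 h20 h02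
  have hs' : s = 0 ∨ s = 1 := by omega
  have ht' : t = 0 ∨ t = 1 := by omega
  rcases hs' with rfl | rfl <;> rcases ht' with rfl | rfl <;>
    simp only [pow_zero, pow_one, one_mul, mul_one,
      zero_ne_one, and_false, false_and, if_false, if_true, and_self]
  · exact key (by rwa [hQ]) hQ
  · refine key (P' := h • (x * Q - y * Q)) ?_ ?_
    · have e : F (y * Q) = h • (x * Q - y * Q) := by
        rw [map_mul, hy, hQ, Algebra.smul_def]; ring
      have := B.smul_mem h (sub_mem h10 h01)
      rw [e, map_smul, map_sub, smul_comm, ← smul_sub]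
      rwa [sub_sub_sub_comm, ← smul_sub (1 / 4 : ℂ)] at this
    · rw [map_smul, map_sub, map_mul, map_mul, hx, hy, hQ, Algebra.smul_def]
      linear_combination 2 * y * Q * hC + y * Q * hC2
  · refine key (P' := h • (x * Q + y * Q)) ?_ ?_
    · have e : F (x * Q) = h • (x * Q + y * Q) := by
        rw [map_mul, hx, hQ, Algebra.smul_def]; ring
      have := B.smul_mem h (add_mem h10 h01)
      rw [e, map_smul, map_add, smul_comm, ← smul_sub]
      rwa [sub_add_sub_comm, ← smul_add (1 / 4 : ℂ)] at this
    · rw [map_smul, map_add, map_mul, map_mul, hx, hy, hQ, Algebra.smul_def]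
      linear_combination 2 * x * Q * hC + x * Q * hC2
  -- Here h²(x + y)(x - y) has no cross term, and G acts by the same scalar -1/4 on x² and y².
  · refine key (P' := (1 / 2 : ℂ) • (x ^ 2 * Q - y ^ 2 * Q)) ?_ ?_
    · have e : F (x * y * Q) = (1 / 2 : ℂ) • (x ^ 2 * Q - y ^ 2 * Q) := by
        rw [map_mul, map_mul, hx, hy, hQ, Algebra.smul_def, ← hC]; ring
      have := B.smul_mem (1 / 2 : ℂ) (sub_mem h20 h02)
      rw [e, map_smul, map_sub, smul_comm, ← smul_sub]
      rwa [sub_sub_sub_comm, ← smul_sub (1 / 4 * -1 : ℂ)] at this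
    · rw [map_smul, map_sub, map_mul, map_mul, map_pow, map_pow, hx, hy, hQ, Algebra.smul_def,
        mul_pow, mul_pow, hC]
      linear_combination (x * y * Q * (2 * algebraMap ℂ R (1 / 2) + 1)) * hC2

/-- The transformation of the modes in the CSIGN gadget. -/
def csignGadget (p q a b c d : Fin m) : Matrix (Fin m) (Fin m) ℂ :=
  onModes ![p, q] (hadamard : Matrix (Fin 2) (Fin 2) ℂ) * onModes ![q, c, d] W *
    onModes ![p, a, b] W * onModes ![p, q] (hadamard : Matrix (Fin 2) (Fin 2) ℂ)

theorem modeHom_csignGadget {p q a b c d : Fin m} (he : Function.Injective ![p, q, a, b, c, d])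
    {T : Fin m →₀ ℕ} (hp : T p ≤ 1) (hq : T q ≤ 1) (ha : T a = 0) (hb : T b = 1) (hc : T c = 0)
    (hd : T d = 1) {α : Fin m → ℕ} (hαa : α a = 0) (hαb : α b = 1) (hαc : α c = 0)
    (hαd : α d = 1) :
    modeHom (csignGadget p q a b c d) (monomial T 1) -
      (1 / 4 * (if T p = 1 ∧ T q = 1 then -1 else 1) : ℂ) • monomial T 1 ∈
      offSector {a, b, c, d} α := by
  have hpq : p ≠ q := fun h => absurd (@he 0 1 h) (by decide)
  have hpa : p ≠ a := fun h => absurd (@he 0 2 h) (by decide)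
  have hpb : p ≠ b := fun h => absurd (@he 0 3 h) (by decide)
  have hpc : p ≠ c := fun h => absurd (@he 0 4 h) (by decide)
  have hpd : p ≠ d := fun h => absurd (@he 0 5 h) (by decide)
  have hqa : q ≠ a := fun h => absurd (@he 1 2 h) (by decide)
  have hqb : q ≠ b := fun h => absurd (@he 1 3 h) (by decide)
  have hqc : q ≠ c := fun h => absurd (@he 1 4 h) (by decide)
  have hqd : q ≠ d := fun h => absurd (@he 1 5 h) (by decide)
  obtain ⟨h, hh, hHp, hHq⟩ := exists_modeHom_hadamard hpq
  set N := (T.erase p).erase q with hN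
  have hNp : N p = 0 := by rw [hN, Finsupp.erase_ne hpq, Finsupp.erase_same]
  have hNq : N q = 0 := Finsupp.erase_same
  have hN' : ∀ l, p ≠ l → q ≠ l → N l = T l := fun l h h' => by
    rw [hN, Finsupp.erase_ne h'.symm, Finsupp.erase_ne h.symm]
  have hT : (monomial T 1 : MvPolynomial (Fin m) ℂ) = X p ^ T p * X q ^ T q * monomial N 1 := by
    rw [monomial_split T p, monomial_split (T.erase p) q, Finsupp.erase_ne hpq.symm, mul_assoc]
  rw [hT, csignGadget, modeHom_mul, modeHom_mul, modeHom_mul]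
  refine conj_signFlip_mem
    (G := (modeHom (onModes ![q, c, d] W)).comp (modeHom (onModes ![p, a, b] W)))
    (fun P hP => FixesModes.modeHom_mem (fixesModes_onModes ?_) hP) hh hHp hHq
    (modeHom_onModes_monomial ?_) (fun s t hs ht => ?_) hp hq
  · simp [Fin.forall_fin_succ, hpa, hpb, hpc, hpd, hqa, hqb, hqc, hqd]
  · simp [Fin.forall_fin_succ, hNp, hNq]
  · exact modeHom_onModes_W_W he hNp hNq (hN' a hpa hqa ▸ ha) (hN' b hpb hqb ▸ hb)
      (hN' c hpc hqc ▸ hc) (hN' d hpd hqd ▸ hd) hαa hαb hαc hαd hs ht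

end Gadgets

/-! ### Amplitudes of the gadgets -/

theorem fock_onModes_W {m n : ℕ} {i j k : Fin m} (he : Function.Injective ![i, j, k])
    {S T : Occ m n} (hi : T.1 i ≤ 2) (hj : T.1 j = 0) (hk : T.1 k = 1) (hj' : S.1 j = 0)
    (hk' : S.1 k = 1) :
    fock n (onModes ![i, j, k] W) S T = if S = T then 1 / 2 * ns₁ (T.1 i) else 0 :=
  fock_eq_ite (A := {j, k}) (α := S.1) (fun _ _ => rfl)
    (modeHom_onModes_W he hi hj hk (by simp) (by simp) hj' hk')

theorem fock_csignGadget {m n : ℕ} {p q a b c d : Fin m}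
    (he : Function.Injective ![p, q, a, b, c, d]) {S T : Occ m n} (hp : T.1 p ≤ 1)
    (hq : T.1 q ≤ 1) (ha : T.1 a = 0) (hb : T.1 b = 1) (hc : T.1 c = 0) (hd : T.1 d = 1)
    (ha' : S.1 a = 0) (hb' : S.1 b = 1) (hc' : S.1 c = 0) (hd' : S.1 d = 1) :
    fock n (csignGadget p q a b c d) S T =
      if S = T then 1 / 4 * (if T.1 p = 1 ∧ T.1 q = 1 then -1 else 1) else 0 :=
  fock_eq_ite (A := {a, b, c, d}) (α := S.1) (fun _ _ => rfl)
    (modeHom_csignGadget he hp hq ha hb hc hd ha' hb' hc' hd')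

/-! ### Two-mode gates -/

section Products

/-- The entries of U are the coefficients of the images of the variables. This lets identities
between `onModes` matrices be checked on variables instead of entry by entry. -/
theorem matrix_eq_of_modeHom_X {ι : Type*} [Fintype ι] {U V : Matrix ι ι ℂ}
    (h : ∀ j, modeHom U (X j) = modeHom V (X j)) : U = V := by
  classical
  ext i j
  have := congrArg (coeff (Finsupp.single i 1)) (h j)
  simpa [modeHom_X, coeff_sum, coeff_C_mul, coeff_X, Finsupp.single_left_inj] using this

theorem onModes_mul {r m : ℕ} {e : Fin r → Fin m} (he : Function.Injective e)
    (U V : Matrix (Fin r) (Fin r) ℂ) : onModes e (U * V) = onModes e U * onModes e V := by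
  refine matrix_eq_of_modeHom_X fun j => ?_
  rw [modeHom_mul]
  by_cases hj : ∃ t, e t = j
  · obtain ⟨t, rfl⟩ := hj
    simp only [modeHom_onModes_apply he, map_sum, map_mul, algHom_C, algebraMap_eq,
      Matrix.mul_apply, Finset.sum_mul, Finset.mul_sum]
    rw [Finset.sum_comm]
    exact Finset.sum_congr rfl fun _ _ => Finset.sum_congr rfl fun _ _ => by ring
  · have hj' : ∀ s, e s ≠ j := fun s hs => hj ⟨s, hs⟩
    simp only [modeHom_onModes_of_notMem hj']

theorem onModes_one {r m : ℕ} {e : Fin r → Fin m} (he : Function.Injective e) :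
    onModes e (1 : Matrix (Fin r) (Fin r) ℂ) = 1 := by
  refine matrix_eq_of_modeHom_X fun j => ?_
  rw [modeHom_one]
  by_cases hj : ∃ t, e t = j
  · obtain ⟨t, rfl⟩ := hj
    simp [modeHom_onModes_apply he, Matrix.one_apply]
  · exact modeHom_onModes_of_notMem fun s hs => hj ⟨s, hs⟩

/-- This is what moves the two-mode gates of `w` from three abstract modes to the actual modes of a
large circuit. -/
theorem onModes_comp {q r m : ℕ} {e : Fin r → Fin m} {f : Fin q → Fin r}
    (he : Function.Injective e) (hf : Function.Injective f) (U : Matrix (Fin q) (Fin q) ℂ) :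
    onModes (e ∘ f) U = onModes e (onModes f U) := by
  classical
  refine matrix_eq_of_modeHom_X fun j => ?_
  by_cases hj : ∃ t, e t = j
  · obtain ⟨t, rfl⟩ := hj
    rw [modeHom_onModes_apply he]
    by_cases ht : ∃ u, f u = t
    · obtain ⟨u, rfl⟩ := ht
      rw [show e (f u) = (e ∘ f) u from rfl, modeHom_onModes_apply (he.comp hf),
        ← Finset.sum_subset (Finset.subset_univ (Finset.univ.image f)), Finset.sum_image hf.injOn]
      · simp only [onModes_apply_apply hf, Function.comp_apply]
      · intro a _ ha
        have ha' : ∀ s, f s ≠ a := by simpa using ha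
        rw [onModes_apply_of_notMem_left ha', if_neg (ha' u).symm, C_0, zero_mul]
    · have ht' : ∀ s, f s ≠ t := fun s hs => ht ⟨s, hs⟩
      rw [modeHom_onModes_of_notMem (e := e ∘ f) fun s hs => ht' s (he hs)]
      simp [onModes_apply_of_notMem_right ht']
  · have hj' : ∀ s, e s ≠ j := fun s hs => hj ⟨s, hs⟩
    rw [modeHom_onModes_of_notMem hj', modeHom_onModes_of_notMem (e := e ∘ f) fun s => hj' (f s)]

theorem foldl_mul_eq {α R : Type*} [Monoid R] (f : α → R) (l : List α) (a : R) :
    l.foldl (fun M g => f g * M) a = l.foldl (fun M g => f g * M) 1 * a := by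
  induction l generalizing a with
  | nil => simp
  | cons g l ih => simp only [List.foldl_cons]; rw [ih, ih (f g * 1), mul_one, mul_assoc]

variable {B : Type} {m : ℕ} (ρ : B → unitaryGroup (Fin 2) ℂ)

@[simp]
theorem loMatrix_nil : loMatrix ρ ([] : List (LOGate B m)) = 1 := rfl

@[simp]
theorem loMatrix_cons (g : LOGate B m) (gs : List (LOGate B m)) :
    loMatrix ρ (g :: gs) = loMatrix ρ gs * g.matrix ρ := by
  simp only [loMatrix, List.foldl_cons]
  rw [foldl_mul_eq, mul_one]

@[simp]
theorem loMatrix_append (gs gs' : List (LOGate B m)) :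
    loMatrix ρ (gs ++ gs') = loMatrix ρ gs' * loMatrix ρ gs := by
  induction gs with
  | nil => simp
  | cons g gs ih => simp [ih, Matrix.mul_assoc]

theorem loMatrix_eq_of_map_eq {B' : Type} {ρ' : B' → unitaryGroup (Fin 2) ℂ}
    {gs : List (LOGate B m)} {gs' : List (LOGate B' m)}
    (h : gs.map (LOGate.matrix ρ) = gs'.map (LOGate.matrix ρ')) :
    loMatrix ρ gs = loMatrix ρ' gs' := by
  have key : ∀ {B : Type} (ρ : B → unitaryGroup (Fin 2) ℂ) (gs : List (LOGate B m)),
      loMatrix ρ gs = (gs.map (LOGate.matrix ρ)).foldl (fun M N => N * M) 1 := by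
    intro B ρ gs
    rw [List.foldl_map]
    rfl
  rw [key, key, h]

/-- A list of gates on the modes `e 0, …, e (r-1)`. -/
def liftGates {r : ℕ} (e : Fin r ↪ Fin m) (gs : List (LOGate B r)) : List (LOGate B m) :=
  gs.map fun g => ⟨g.label, e g.fst, e g.snd, e.injective.ne g.ne⟩

theorem LOGate.fst_snd_injective {r : ℕ} (g : LOGate B r) : Function.Injective ![g.fst, g.snd] := by
  intro s t h
  have := g.ne
  fin_cases s <;> fin_cases t <;> simp_all

theorem loMatrix_liftGates {r : ℕ} (e : Fin r ↪ Fin m) (gs : List (LOGate B r)) :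
    loMatrix ρ (liftGates e gs) = onModes e (loMatrix ρ gs) := by
  induction gs with
  | nil => simp [liftGates, onModes_one e.injective]
  | cons g gs ih =>
    simp only [liftGates, List.map_cons, loMatrix_cons] at ih ⊢
    rw [ih, onModes_mul e.injective]
    congr 1
    simp only [LOGate.matrix]
    rw [← onModes_comp e.injective g.fst_snd_injective]
    congr 1
    ext s
    fin_cases s <;> rfl

/-- `placeW` names its gates by their position in `w`, so it differs from `liftGates` only in the
labels. Under `LOLabel.unitary` both lists have the same matrices. -/
theorem loMatrix_placeW {w : List (LOGate (unitaryGroup (Fin 2) ℂ) 3)} (hw : loMatrix id w = W)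
    (ρ : List Bool → unitaryGroup (Fin 2) ℂ) (e : Fin 3 ↪ Fin m) :
    loMatrix (LOLabel.unitary w ρ) (placeW w e) = onModes e W := by
  rw [← hw, ← loMatrix_liftGates]
  refine loMatrix_eq_of_map_eq _ ?_
  rw [placeW, List.map_ofFn, liftGates, List.map_map]
  conv_rhs => rw [← List.ofFn_get w, List.map_ofFn]
  rfl

end Products

/-! ### Decomposition of a `3 × 3` unitary -/

section Givens

/-- A unitary that turns a vector of `ℂ²` into a nonnegative multiple of the first basis vector. -/
theorem exists_unitary_rotate (a b : ℂ) : ∃ (u : unitaryGroup (Fin 2) ℂ) (r : ℝ), 0 ≤ r ∧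
    (u : Matrix (Fin 2) (Fin 2) ℂ) 0 0 * a + (u : Matrix (Fin 2) (Fin 2) ℂ) 0 1 * b = r ∧
    (u : Matrix (Fin 2) (Fin 2) ℂ) 1 0 * a + (u : Matrix (Fin 2) (Fin 2) ℂ) 1 1 * b = 0 := by
  by_cases h : a = 0 ∧ b = 0
  · exact ⟨1, 0, le_rfl, by simp [h.1, h.2], by simp [h.1, h.2]⟩
  set r : ℝ := √(Complex.normSq a + Complex.normSq b) with hr
  have hpos : 0 < Complex.normSq a + Complex.normSq b := by
    rcases not_and_or.1 h with h | h
    · exact add_pos_of_pos_of_nonneg (Complex.normSq_pos.2 h) (Complex.normSq_nonneg b)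
    · exact add_pos_of_nonneg_of_pos (Complex.normSq_nonneg a) (Complex.normSq_pos.2 h)
  have hr0 : (r : ℂ) ≠ 0 := by exact_mod_cast (Real.sqrt_pos.2 hpos).ne'
  have hr2 : (r : ℂ) ^ 2 = a * star a + b * star b := by
    rw [← Complex.ofReal_pow, hr, Real.sq_sqrt hpos.le, Complex.ofReal_add, Complex.star_def,
      Complex.mul_conj, Complex.mul_conj]
  refine ⟨⟨!![star a / r, star b / r; -b / r, a / r], ?_⟩, r, Real.sqrt_nonneg _, ?_, ?_⟩
  · rw [mem_unitaryGroup_iff]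
    ext i j
    simp only [Complex.star_def] at hr2
    fin_cases i <;> fin_cases j <;>
      simp [Matrix.mul_apply, Fin.sum_univ_two, Matrix.star_eq_conjTranspose] <;> field_simp <;>
      first | linear_combination -hr2 | linear_combination hr2 | ring
  · simp only [Complex.star_def] at hr2
    simp
    field_simp
    linear_combination -hr2
  · simp
    field_simp
    ring

theorem onModes_mem_unitaryGroup {r m : ℕ} {e : Fin r → Fin m} (he : Function.Injective e)
    {U : Matrix (Fin r) (Fin r) ℂ} (hU : U ∈ unitaryGroup (Fin r) ℂ) :
    onModes e U ∈ unitaryGroup (Fin m) ℂ := by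
  have hstar : star (onModes e U) = onModes e (star U) := by
    ext a b
    rw [Matrix.star_apply]
    by_cases ha : ∃ s, e s = a
    · obtain ⟨s, rfl⟩ := ha
      by_cases hb : ∃ t, e t = b
      · obtain ⟨t, rfl⟩ := hb
        rw [onModes_apply_apply he, onModes_apply_apply he, Matrix.star_apply]
      · have hb' : ∀ t, e t ≠ b := fun t ht => hb ⟨t, ht⟩
        rw [onModes_apply_of_notMem_left hb', onModes_apply_of_notMem_right hb',
          if_neg (hb' s).symm, if_neg (hb' s), star_zero]
    · have ha' : ∀ s, e s ≠ a := fun s hs => ha ⟨s, hs⟩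
      rw [onModes_apply_of_notMem_left ha', onModes_apply_of_notMem_right ha']
      by_cases h : a = b
      · simp [h]
      · simp [h, Ne.symm h]
  rw [mem_unitaryGroup_iff, hstar, ← onModes_mul he, mem_unitaryGroup_iff.1 hU, onModes_one he]

/-- A `3 × 3` unitary is a product of three two-mode gates. -/
theorem exists_loMatrix_eq {V : Matrix (Fin 3) (Fin 3) ℂ} (hV : V ∈ unitaryGroup (Fin 3) ℂ) :
    ∃ w : List (LOGate (unitaryGroup (Fin 2) ℂ) 3), loMatrix id w = V := by
  have h01 : Function.Injective ![(0 : Fin 3), 1] := by decide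
  have h02 : Function.Injective ![(0 : Fin 3), 2] := by decide
  have h12 : Function.Injective ![(1 : Fin 3), 2] := by decide
  obtain ⟨u, -, -, -, hu⟩ := exists_unitary_rotate (V 0 0) (V 1 0)
  set A := onModes ![(0 : Fin 3), 1] (u : Matrix (Fin 2) (Fin 2) ℂ) * V with hA
  have hAu : A ∈ unitaryGroup (Fin 3) ℂ := mul_mem (onModes_mem_unitaryGroup h01 u.2) hV
  have hA1 : A 1 0 = 0 := by
    rw [← hu]
    simp [hA, onModes, Matrix.mul_apply, Fin.sum_univ_three, Fin.sum_univ_two]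
  -- The first rotation only has to kill an entry. The second also records that the corner is a
  -- nonnegative real r, which later turns r² = 1 into r = 1.
  obtain ⟨u', r, hr, hu0, hu1⟩ := exists_unitary_rotate (A 0 0) (A 2 0)
  set D := onModes ![(0 : Fin 3), 2] (u' : Matrix (Fin 2) (Fin 2) ℂ) * A with hD
  have hDu : D ∈ unitaryGroup (Fin 3) ℂ := mul_mem (onModes_mem_unitaryGroup h02 u'.2) hAu
  have hD0 : D 0 0 = r := by
    rw [← hu0]
    simp [hD, onModes, Matrix.mul_apply, Fin.sum_univ_three, Fin.sum_univ_two]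
  have hD1 : D 1 0 = 0 := by
    rw [← hA1]
    simp [hD, onModes, Matrix.mul_apply, Fin.sum_univ_two]
  have hD2 : D 2 0 = 0 := by
    rw [← hu1]
    simp [hD, onModes, Matrix.mul_apply, Fin.sum_univ_three, Fin.sum_univ_two]
  -- The first column of D is (r, 0, 0), so its norm gives r² = 1. The norm of the first row then
  -- leaves nothing for the other two entries, and D is 1 plus a 2 × 2 block.
  have hcol := congrFun₂ (mem_unitaryGroup_iff'.1 hDu) 0 0
  have hrow := congrFun₂ (mem_unitaryGroup_iff.1 hDu) 0 0
  simp only [Matrix.mul_apply, Fin.sum_univ_three, Matrix.star_apply, hD0, hD1, hD2,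
    Matrix.one_apply_eq, Complex.star_def, Complex.conj_ofReal, mul_zero, add_zero,
    Complex.mul_conj, ← Complex.ofReal_mul] at hcol hrow
  have hr1 : r * r = 1 := by exact_mod_cast hcol
  have hrow' : r * r + Complex.normSq (D 0 1) + Complex.normSq (D 0 2) = 1 := by
    rw [Complex.normSq_ofReal] at hrow
    exact_mod_cast hrow
  have h1 := Complex.normSq_nonneg (D 0 1)
  have h2 := Complex.normSq_nonneg (D 0 2)
  have hD01 : D 0 1 = 0 := Complex.normSq_eq_zero.1 (by linarith)
  have hD02 : D 0 2 = 0 := Complex.normSq_eq_zero.1 (by linarith)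
  have hD00 : D 0 0 = 1 := by rw [hD0, show r = 1 by nlinarith, Complex.ofReal_one]
  clear_value D
  obtain ⟨v, hv⟩ : ∃ v, v = D.submatrix ![(1 : Fin 3), 2] ![1, 2] := ⟨_, rfl⟩
  have h0 : ∀ s, (![1, 2] : Fin 2 → Fin 3) s ≠ 0 := by decide
  have hDv : D = onModes ![(1 : Fin 3), 2] v := by
    ext i j
    obtain rfl | ⟨s, rfl⟩ : i = 0 ∨ ∃ s, (![1, 2] : Fin 2 → Fin 3) s = i := by
      revert i; decide
    · rw [onModes_apply_of_notMem_left h0]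
      fin_cases j
      · exact hD00
      · exact hD01
      · exact hD02
    · obtain rfl | ⟨t, rfl⟩ : j = 0 ∨ ∃ s, (![1, 2] : Fin 2 → Fin 3) s = j := by
        revert j; decide
      · rw [onModes_apply_of_notMem_right h0, if_neg (h0 s)]
        fin_cases s
        · exact hD1
        · exact hD2
      · rw [onModes_apply_apply h12, hv, Matrix.submatrix_apply]
  have hvu : v ∈ unitaryGroup (Fin 2) ℂ := by
    have h := mem_unitaryGroup_iff.1 hDu
    rw [mem_unitaryGroup_iff]
    ext i j
    have hij := congrFun₂ h (![(1 : Fin 3), 2] i) (![(1 : Fin 3), 2] j)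
    rw [Matrix.mul_apply, Fin.sum_univ_three] at hij
    rw [Matrix.mul_apply, Fin.sum_univ_two]
    have hDs : ∀ s, D ((![1, 2] : Fin 2 → Fin 3) s) 0 = 0 := by
      intro s
      fin_cases s
      · exact hD1
      · exact hD2
    rw [hDs, zero_mul, zero_add, Matrix.one_apply] at hij
    simp only [h12.eq_iff] at hij
    rw [Matrix.one_apply, ← hij, hv]
    rfl
  have inv : ∀ {e : Fin 2 → Fin 3} (_ : Function.Injective e) (u : unitaryGroup (Fin 2) ℂ)
      (M : Matrix (Fin 3) (Fin 3) ℂ), onModes e ((u⁻¹ : unitaryGroup (Fin 2) ℂ) :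
        Matrix (Fin 2) (Fin 2) ℂ) * (onModes e (u : Matrix (Fin 2) (Fin 2) ℂ) * M) = M := by
    intro e he u M
    rw [← Matrix.mul_assoc, ← onModes_mul he, ← Submonoid.coe_mul, inv_mul_cancel,
      Submonoid.coe_one, onModes_one he, Matrix.one_mul]
  refine ⟨[⟨⟨v, hvu⟩, 1, 2, by decide⟩, ⟨u'⁻¹, 0, 2, by decide⟩, ⟨u⁻¹, 0, 1, by decide⟩], ?_⟩
  simp only [loMatrix_cons, loMatrix_nil, Matrix.one_mul, LOGate.matrix, id]
  rw [← hDv, Matrix.mul_assoc, hD, inv h02, hA, inv h01]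

end Givens

/-! ### Correctness of the translation -/

section Translation

variable {k n : ℕ}

/-- The exponents of the dual-rail encoding of `|x⟩` in `2n` modes, the modes from `2k` on being
in the state `|0,1,…,0,1⟩`. -/
def railExp (n : ℕ) (x : Fin k → Fin 2) : Fin (2 * n) →₀ ℕ :=
  Finsupp.equivFunOnFinite.symm fun p => if h : (p : ℕ) / 2 < k then
    (if (p : ℕ) % 2 = 0 then (x ⟨p / 2, h⟩ : ℕ) else 1 - (x ⟨p / 2, h⟩ : ℕ)) else (p : ℕ) % 2

theorem toFinsupp_dualRail (r : ℕ) (x : Fin k → Fin 2) :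
    (dualRail r x).toFinsupp = railExp (k + r) x := rfl

theorem railExp_even (x : Fin k → Fin 2) (i : Fin k) (h : 2 * (i : ℕ) < 2 * n) :
    railExp n x ⟨2 * i, h⟩ = x i := by
  simp [railExp]

theorem railExp_odd (x : Fin k → Fin 2) (i : Fin k) (h : 2 * (i : ℕ) + 1 < 2 * n) :
    railExp n x ⟨2 * i + 1, h⟩ = 1 - x i := by
  have h1 : (2 * (i : ℕ) + 1) / 2 = i := by omega
  have h2 : (2 * (i : ℕ) + 1) % 2 = 1 := by omega
  simp [railExp, h1, h2]

theorem railExp_of_le (x : Fin k → Fin 2) {p : Fin (2 * n)} (h : 2 * k ≤ (p : ℕ)) :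
    railExp n x p = (p : ℕ) % 2 := by
  have h1 : ¬ (p : ℕ) / 2 < k := by omega
  simp [railExp, h1]

theorem railExp_update_of_ne (x : Fin k → Fin 2) (i : Fin k) (b : Fin 2) {p : Fin (2 * n)}
    (h : (p : ℕ) / 2 ≠ i) : railExp n (Function.update x i b) p = railExp n x p := by
  simp only [railExp, Finsupp.equivFunOnFinite_symm_apply_apply]
  split_ifs with h1 <;> try rfl
  all_goals rw [Function.update_of_ne]; exact fun h' => h (congrArg Fin.val h')

/-- Exactly one mode of qubit i is occupied, and the vector lists the modes so that entry b is the
one for the value b. As M does not depend on b, a 2 × 2 unitary acts on these two variables as it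
does on the qubit, with no off-sector error. -/
theorem monomial_railExp_update (x : Fin k → Fin 2) (i : Fin k) (h0 : 2 * (i : ℕ) < 2 * n)
    (h1 : 2 * (i : ℕ) + 1 < 2 * n) : ∃ M : Fin (2 * n) →₀ ℕ,
      (∀ s, M ((![⟨2 * i + 1, h1⟩, ⟨2 * i, h0⟩] : Fin 2 → Fin (2 * n)) s) = 0) ∧
      ∀ b, (monomial (railExp n (Function.update x i b)) 1 : MvPolynomial (Fin (2 * n)) ℂ) =
        X ((![⟨2 * i + 1, h1⟩, ⟨2 * i, h0⟩] : Fin 2 → Fin (2 * n)) b) * monomial M 1 := by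
  have hne : (⟨2 * i + 1, h1⟩ : Fin (2 * n)) ≠ ⟨2 * i, h0⟩ := by simp
  refine ⟨((railExp n x).erase ⟨2 * i, h0⟩).erase ⟨2 * i + 1, h1⟩, ?_, fun b => ?_⟩
  · simp [Fin.forall_fin_succ, Finsupp.erase_ne hne.symm]
  · have hM : ((railExp n (Function.update x i b)).erase ⟨2 * i, h0⟩).erase ⟨2 * i + 1, h1⟩ =
        ((railExp n x).erase ⟨2 * i, h0⟩).erase ⟨2 * i + 1, h1⟩ := by
      ext p
      by_cases hp1 : p = ⟨2 * i + 1, h1⟩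
      · subst hp1; simp
      rw [Finsupp.erase_ne hp1, Finsupp.erase_ne hp1]
      by_cases hp0 : p = ⟨2 * i, h0⟩
      · subst hp0; simp
      rw [Finsupp.erase_ne hp0, Finsupp.erase_ne hp0, railExp_update_of_ne]
      intro h
      rw [Fin.ext_iff] at hp1 hp0
      simp only at hp1 hp0
      omega
    rw [monomial_split _ ⟨2 * i, h0⟩, monomial_split (Finsupp.erase _ _) ⟨2 * i + 1, h1⟩, hM,
      Finsupp.erase_ne hne, railExp_even, railExp_odd, Function.update_self]
    fin_cases b <;> simp

theorem sum_ite_eq_sum_update {M : Type*} [AddCommMonoid M] (x : Fin k → Fin 2) (i : Fin k)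
    (f : (Fin k → Fin 2) → M) :
    ∑ y, (if ∀ l, l ≠ i → y l = x l then f y else 0) = ∑ b, f (Function.update x i b) := by
  classical
  rw [← Finset.sum_filter]
  symm
  refine Finset.sum_bij (fun b _ => Function.update x i b) ?_ ?_ ?_ ?_
  · simp +contextual
  · intro b _ b' _ h
    simpa using congrFun h i
  · intro y hy
    refine ⟨y i, Finset.mem_univ _, ?_⟩
    have := (Finset.mem_filter.1 hy).2
    ext1 l
    by_cases h : l = i
    · subst h; simp
    · rw [Function.update_of_ne h, this l h]
  · simp

theorem modeHom_one_gate (u : unitaryGroup (Fin 2) ℂ) (x : Fin k → Fin 2) (i : Fin k)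
    (h0 : 2 * (i : ℕ) < 2 * n) (h1 : 2 * (i : ℕ) + 1 < 2 * n) :
    modeHom (onModes ![⟨2 * i + 1, h1⟩, ⟨2 * i, h0⟩] (u : Matrix (Fin 2) (Fin 2) ℂ))
        (monomial (railExp n x) 1) =
      ∑ y, (if ∀ l, l ≠ i → y l = x l then (u : Matrix (Fin 2) (Fin 2) ℂ) (y i) (x i) else 0) •
        monomial (railExp n y) 1 := by
  have he : Function.Injective ![(⟨2 * i + 1, h1⟩ : Fin (2 * n)), ⟨2 * i, h0⟩] := by
    intro s t h
    fin_cases s <;> fin_cases t <;> simp_all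
  obtain ⟨M, hM, hmon⟩ := monomial_railExp_update (n := n) x i h0 h1
  have hx := hmon (x i)
  rw [Function.update_eq_self] at hx
  rw [hx, map_mul, modeHom_onModes_apply he, modeHom_onModes_monomial hM]
  simp only [ite_smul, zero_smul]
  rw [sum_ite_eq_sum_update x i
    (fun y => (u : Matrix (Fin 2) (Fin 2) ℂ) (y i) (x i) • monomial (railExp n y) (1 : ℂ))]
  simp only [hmon, Function.update_self, Finset.sum_mul, smul_eq_C_mul, mul_assoc]

/-- Composition of two transformations that act on the span of the vectors `v x` within sectors. -/
theorem modeHom_mul_sub_sum_mem {ι κ : Type*} [Fintype ι] [Fintype κ] {U G : Matrix ι ι ℂ}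
    {A B : Set ι} (hAB : A ⊆ B) (hU : FixesModes U A) {α : ι → ℕ} {v : κ → MvPolynomial ι ℂ}
    {M N : Matrix κ κ ℂ} {x : κ}
    (hG : modeHom G (v x) - ∑ z, N z x • v z ∈ offSector A α)
    (hU' : ∀ z, modeHom U (v z) - ∑ y, M y z • v y ∈ offSector B α) :
    modeHom (U * G) (v x) - ∑ y, (M * N) y x • v y ∈ offSector B α := by
  -- The total error is the error of G carried through U, plus the errors of U weighted by the
  -- column x of N.
  have h1 := offSector_mono hAB α (hU.modeHom_mem hG)
  have h2 : ∑ z, N z x • (modeHom U (v z) - ∑ y, M y z • v y) ∈ offSector B α :=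
    Submodule.sum_mem _ fun z _ => Submodule.smul_mem _ _ (hU' z)
  have h3 := add_mem h1 h2
  have h4 : ∑ z, N z x • ∑ y, M y z • v y = ∑ y, (M * N) y x • v y := by
    simp only [Finset.smul_sum, smul_smul, Matrix.mul_apply, Finset.sum_smul]
    rw [Finset.sum_comm]
    simp only [mul_comm]
  simp only [smul_sub, Finset.sum_sub_distrib, map_sub, map_sum, map_smul, h4] at h3
  rwa [sub_add_sub_cancel, ← modeHom_mul] at h3

/-- The matrix of a list of qubit gates. -/
def gatesMatrix {A : Type} (ρ : A → unitaryGroup (Fin 2) ℂ) (gs : List (QGate A k)) :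
    Matrix (Fin k → Fin 2) (Fin k → Fin 2) ℂ :=
  gs.foldl (fun M g => g.matrix ρ * M) 1

theorem gatesMatrix_cons {A : Type} (ρ : A → unitaryGroup (Fin 2) ℂ) (q : QGate A k)
    (gs : List (QGate A k)) : gatesMatrix ρ (q :: gs) = gatesMatrix ρ gs * q.matrix ρ := by
  simp only [gatesMatrix, List.foldl_cons]
  rw [foldl_mul_eq, mul_one]

theorem coe_threeModes {m : ℕ} (a b c : Fin m) (hab : a ≠ b) (hac : a ≠ c) (hbc : b ≠ c) :
    (threeModes a b c hab hac hbc : Fin 3 → Fin m) = ![a, b, c] := rfl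

/-- The list head acts first, so the induction hypothesis concerns the rest of the circuit. Its
first half, that the rest leaves all earlier ancilla modes alone, is what keeps the error of a CSIGN
gadget off sector until the end. -/
theorem translateGates_correct {w : List (LOGate (unitaryGroup (Fin 2) ℂ) 3)}
    (hw : loMatrix id w = W) (ρ : List Bool → unitaryGroup (Fin 2) ℂ) (g : ℕ)
    (gs : List (QGate (List Bool) k)) (h : k + 2 * (g + csignCount gs) ≤ n) :
    FixesModes (loMatrix (LOLabel.unitary w ρ) (translateGates w n g gs h))
      {p | 2 * k ≤ (p : ℕ) ∧ (p : ℕ) < 2 * k + 4 * g} ∧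
    ∀ x, modeHom (loMatrix (LOLabel.unitary w ρ) (translateGates w n g gs h))
        (monomial (railExp n x) 1) -
      ∑ y, (((1 / 4 : ℂ) ^ csignCount gs) • gatesMatrix ρ gs) y x •
        monomial (railExp n y) (1 : ℂ) ∈
      offSector {p : Fin (2 * n) | 2 * k ≤ (p : ℕ)} (fun p => (p : ℕ) % 2) := by
  induction gs generalizing g with
  | nil =>
    refine ⟨FixesModes.one _, fun x => ?_⟩
    simp [translateGates, csignCount, gatesMatrix, modeHom_one, Matrix.one_apply]
  | cons q gs ih =>
    rw [gatesMatrix_cons]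
    cases q with
    | one d i =>
      have hi := i.isLt
      simp only [translateGates, loMatrix_cons, csignCount] at h ⊢
      obtain ⟨ih1, ih2⟩ := ih g h
      refine ⟨ih1.mul (fixesModes_onModes ?_), fun x => ?_⟩
      · simp [Fin.forall_fin_succ]
        omega
      -- With `A = ∅` the sector is everything and only 0 is off sector: a one-qubit gate is exact.
      · have := modeHom_mul_sub_sum_mem (A := ∅) (α := fun p : Fin (2 * n) => (p : ℕ) % 2)
          (G := onModes ![⟨2 * i + 1, by omega⟩, ⟨2 * i, by omega⟩]
            (ρ d : Matrix (Fin 2) (Fin 2) ℂ)) (N := (QGate.one d i).matrix ρ) (x := x)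
          (v := fun x : Fin k → Fin 2 => monomial (railExp n x) 1) (Set.empty_subset _)
          (ih1.mono (Set.empty_subset _)) ?_ ih2
        · rw [← Matrix.smul_mul]
          exact this
        · rw [modeHom_one_gate]
          simp [QGate.matrix]
    | csign i j hij =>
      have hi := i.isLt
      have hj := j.isLt
      have hne : (i : ℕ) ≠ j := fun e => hij (Fin.ext e)
      simp only [translateGates, loMatrix_append, loMatrix_cons, csignCount, loMatrix_nil,
        Matrix.one_mul, loMatrix_placeW hw, coe_threeModes] at h ⊢
      obtain ⟨ih1, ih2⟩ := ih (g + 1) (by omega)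
      set U := loMatrix (LOLabel.unitary w ρ) (translateGates w n (g + 1) gs (by omega))
      have e : ∀ V₁ V₂ V₃ V₄ : Matrix (Fin (2 * n)) (Fin (2 * n)) ℂ,
          U * (V₁ * (V₂ * (V₃ * V₄))) = U * (V₁ * V₂ * V₃ * V₄) := fun _ _ _ _ => by
        simp only [Matrix.mul_assoc]
      rw [e]
      refine ⟨(ih1.mono ?_).mul (((FixesModes.mul ?_ ?_).mul ?_).mul ?_), fun x => ?_⟩
      · intro p hp
        simp only [Set.mem_ofPred_eq] at hp ⊢
        omega
      · refine fixesModes_onModes ?_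
        simp [Fin.forall_fin_succ]
      · refine fixesModes_onModes ?_
        simp [Fin.forall_fin_succ]
      · refine fixesModes_onModes ?_
        simp [Fin.forall_fin_succ]
      · refine fixesModes_onModes ?_
        simp [Fin.forall_fin_succ]
      · have hinj : Function.Injective ![(⟨2 * i, by omega⟩ : Fin (2 * n)), ⟨2 * j, by omega⟩,
            ⟨2 * k + 4 * g, by omega⟩, ⟨2 * k + 4 * g + 1, by omega⟩,
            ⟨2 * k + 4 * g + 2, by omega⟩, ⟨2 * k + 4 * g + 3, by omega⟩] := by
          intro s t
          fin_cases s <;> fin_cases t <;> simp <;> omega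
        have hG := modeHom_csignGadget hinj (T := railExp n x) (α := fun p => (p : ℕ) % 2)
          (by rw [railExp_even]; omega) (by rw [railExp_even]; omega)
          (by rw [railExp_of_le] <;> simp <;> omega) (by rw [railExp_of_le] <;> simp <;> omega)
          (by rw [railExp_of_le] <;> simp <;> omega) (by rw [railExp_of_le] <;> simp <;> omega)
          (by simp; omega) (by simp; omega) (by simp; omega) (by simp; omega)
        rw [railExp_even, railExp_even] at hG
        have hsum : ∑ z, ((1 / 4 : ℂ) • (QGate.csign i j hij).matrix ρ) z x •
            (monomial (railExp n z) 1 : MvPolynomial (Fin (2 * n)) ℂ) =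
            (1 / 4 * (if (x i : ℕ) = 1 ∧ (x j : ℕ) = 1 then -1 else 1) : ℂ) •
              monomial (railExp n x) 1 := by
          have hv : ∀ l, (x l : ℕ) = 1 ↔ x l = 1 := fun l => by rw [Fin.ext_iff]; rfl
          rw [Finset.sum_eq_single x]
          · simp [QGate.matrix, hv]
          · intro z _ hz
            simp [QGate.matrix, hz]
          · simp
        rw [← hsum] at hG
        -- The four modes of this gadget lie below 2k + 4(g + 1), so `ih1` says that the rest of the
        -- circuit fixes them.
        have := modeHom_mul_sub_sum_mem (B := {p : Fin (2 * n) | 2 * k ≤ (p : ℕ)})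
          (v := fun x : Fin k → Fin 2 => monomial (railExp n x) 1) ?_ (ih1.mono ?_) hG ih2
        · rw [Matrix.smul_mul, Matrix.mul_smul, smul_smul, ← pow_succ] at this
          exact this
        · intro p hp
          simp only [Set.mem_insert_iff, Set.mem_singleton_iff] at hp
          rcases hp with rfl | rfl | rfl | rfl <;> simp <;> omega
        · intro p hp
          simp only [Set.mem_insert_iff, Set.mem_singleton_iff] at hp
          rcases hp with rfl | rfl | rfl | rfl <;> simp <;> omega

theorem fock_translate {w : List (LOGate (unitaryGroup (Fin 2) ℂ) 3)}
    (hw : loMatrix id w = W) (ρ : List Bool → unitaryGroup (Fin 2) ℂ) (Q : QCircuit (List Bool))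
    (x : Fin Q.qubits → Fin 2) (S : Occ (2 * (Q.qubits + 2 * Q.numCSIGN))
      (Q.qubits + 2 * Q.numCSIGN))
    (hS : ∀ p : Fin (2 * (Q.qubits + 2 * Q.numCSIGN)), 2 * Q.qubits ≤ (p : ℕ) →
      S.1 p = (p : ℕ) % 2) :
    fock (Q.qubits + 2 * Q.numCSIGN) ((translate w Q).matrix (LOLabel.unitary w ρ))
        S (dualRail (2 * Q.numCSIGN) x) =
      ∑ y : Fin Q.qubits → Fin 2, if S = dualRail (2 * Q.numCSIGN) y
        then Q.matrix ρ y x / 4 ^ Q.numCSIGN else 0 := by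
  have h := (translateGates_correct hw ρ (n := Q.qubits + 2 * Q.numCSIGN) 0 Q.gates
    (by simp [QCircuit.numCSIGN])).2 x S.toFinsupp hS
  rw [coeff_sub, sub_eq_zero, coeff_sum] at h
  -- Dual-rail states have occupation numbers 0 and 1, so the normalization is trivial. Any other S
  -- has coefficient 0 already.
  have hf : ∀ y : Fin Q.qubits → Fin 2,
      (∏ p, (((dualRail (2 * Q.numCSIGN) y).1 p).factorial : ℕ)) = 1 := by
    refine fun y => Finset.prod_eq_one fun p _ => Nat.factorial_eq_one.2 ?_
    simp only [dualRail]
    split_ifs <;> omega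
  change fock _ (loMatrix (LOLabel.unitary w ρ)
    (translateGates w (Q.qubits + 2 * Q.numCSIGN) 0 Q.gates _)) S _ = _
  rw [fock_apply, toFinsupp_dualRail, h, Finset.mul_sum, Finset.sum_div]
  refine Finset.sum_congr rfl fun y _ => ?_
  rw [← toFinsupp_dualRail, coeff_smul, coeff_monomial]
  simp only [Occ.toFinsupp_inj]
  by_cases hy : S = dualRail (2 * Q.numCSIGN) y
  · have h1 := hf x
    have h2 := hf y
    rw [if_pos hy, if_pos hy.symm, hy]
    simp only [← Nat.cast_prod, h1, h2]
    simp [QCircuit.matrix, gatesMatrix, QCircuit.numCSIGN]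
    ring
  · rw [if_neg hy, if_neg (Ne.symm hy)]
    simp

theorem stdState_eq_dualRail (k r : ℕ) :
    stdState (k + r) = dualRail r (fun _ : Fin k => (0 : Fin 2)) := by
  refine Subtype.ext (funext fun p => ?_)
  simp only [stdState, dualRail]
  split_ifs with h1 h2
  · simp [h2]
  · simp; omega
  · rfl

theorem dualRail_injective (k r : ℕ) :
    Function.Injective (dualRail r : (Fin k → Fin 2) → Occ (2 * (k + r)) (k + r)) := by
  intro x y h
  ext i
  have := congrArg (fun S => Occ.toFinsupp S ⟨2 * i, by have := i.isLt; omega⟩) h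
  simpa only [toFinsupp_dualRail, railExp_even] using this

theorem fock_translate_stdState {w : List (LOGate (unitaryGroup (Fin 2) ℂ) 3)}
    (hw : loMatrix id w = W) (ρ : List Bool → unitaryGroup (Fin 2) ℂ)
    (Q : QCircuit (List Bool)) :
    fock (translate w Q).photons ((translate w Q).matrix (LOLabel.unitary w ρ))
        (stdState (translate w Q).photons) (stdState (translate w Q).photons) =
      Q.matrix ρ (fun _ => 0) (fun _ => 0) / 4 ^ Q.numCSIGN := by
  have h := fock_translate hw ρ Q (fun _ => 0) (stdState (Q.qubits + 2 * Q.numCSIGN))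
    fun p _ => rfl
  simp only [stdState_eq_dualRail, (dualRail_injective _ _).eq_iff, Finset.sum_ite_eq,
    Finset.mem_univ, if_true] at h
  rw [← h]
  simp only [translate, stdState_eq_dualRail]

end Translation

end KLM

end

noncomputable section

namespace KLM

open Turing

/-! ### Running time of stack machines -/

section Runs

variable {K : Type} [DecidableEq K] {Γ : K → Type} {Λ σ : Type}

/-- The stack machine `M` goes from `a` to `b` in at most `t` steps. -/
def Runs (M : Λ → TM2.Stmt Γ Λ σ) (t : ℕ) (a b : TM2.Cfg Γ Λ σ) : Prop :=
  ∃ s ≤ t, (flip bind (TM2.step M))^[s] (some a) = some b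

variable {M : Λ → TM2.Stmt Γ Λ σ} {a b c : TM2.Cfg Γ Λ σ} {s t : ℕ}

theorem Runs.refl (a : TM2.Cfg Γ Λ σ) : Runs M 0 a a := ⟨0, le_rfl, rfl⟩

theorem Runs.single (h : TM2.step M a = some b) : Runs M 1 a b := ⟨1, le_rfl, h⟩

theorem Runs.trans (h₁ : Runs M s a b) (h₂ : Runs M t b c) : Runs M (s + t) a c := by
  obtain ⟨s', hs, h₁⟩ := h₁
  obtain ⟨t', ht, h₂⟩ := h₂
  exact ⟨t' + s', by omega, by rw [Function.iterate_add_apply, h₁, h₂]⟩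

theorem Runs.mono (h : Runs M s a b) (hst : s ≤ t) : Runs M t a b := by
  obtain ⟨s', hs, h⟩ := h
  exact ⟨s', hs.trans hst, h⟩

theorem Runs.head (h : TM2.step M a = some b) (h₂ : Runs M t b c) : Runs M (t + 1) a c :=
  ((Runs.single h).trans h₂).mono (by omega)

end Runs

/-! ### The machine -/

/-- The unary counters of the translating machine: the number of modes in use so far, and the two
modes of the gate at hand. -/
inductive Counter : Type
  | used
  | fst
  | snd
  deriving DecidableEq

instance : Fintype Counter := ⟨{.used, .fst, .snd}, by rintro (_ | _ | _) <;> simp⟩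

/-- The stacks of the translating machine: input, output, the reversed list of output gates, the
counters, and scratch space for copying a counter. -/
inductive Stack : Type
  | inp
  | out
  | rev
  | ctr (c : Counter)
  | tmp
  deriving DecidableEq, Fintype

/-- The alphabets of the stacks. -/
abbrev Stack.Alphabet (r : ℕ) : Stack → Type
  | .inp => QSym
  | .out => LOSym r
  | .rev => LOSym r
  | .ctr _ => Unit
  | .tmp => Unit

/-- An output instruction: a symbol, or a counter in unary. -/
inductive Instr (r : ℕ) : Type
  | emit (s : LOSym r)
  | copy (c : Counter)

/-- The string written by an instruction. -/
def Instr.output {r : ℕ} (n : Counter → ℕ) : Instr r → List (LOSym r)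
  | .emit s => [s]
  | .copy c => List.replicate (n c) .tick

/-- The labels of the translating machine, when output programs have at most `N` instructions. -/
inductive Label (N : ℕ) : Type
  | header
  | main
  | readOne
  | readFst
  | readSnd
  | run (b : Bool) (p : Fin (N + 1))
  | restore (b : Bool) (p : Fin (N + 1))
  | clearFst (b : Bool)
  | clearSnd (b : Bool)
  | flush
  | pad
  deriving Fintype

/-- The register of the translating machine: the symbol read last. -/
abbrev Register (r : ℕ) : Type := Option (QSym ⊕ LOSym r)

section Machine

variable {r N : ℕ}

/-- Statements of the translating machine. -/
abbrev Statement (r N : ℕ) : Type := TM2.Stmt (Stack.Alphabet r) (Label N) (Register r)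

/-- Clear the register and continue at `l`. -/
def jump (l : Label N) : Statement r N :=
  .load (fun _ => none) (.goto fun _ => l)

/-- Pop a symbol of the input; on `tick` do `q₁`, otherwise `q₂`. -/
def ifTick (q₁ q₂ : Statement r N) : Statement r N :=
  .pop .inp (fun _ a => a.map .inl) (.branch (fun v => v == some (.inl .tick)) q₁ q₂)

/-- Pop a tick of a counter; if there was one, do `q₁`, otherwise `q₂`. -/
def ifPos (c : Counter) (q₁ q₂ : Statement r N) : Statement r N :=
  .pop (.ctr c) (fun _ a => a.map fun _ => .inl .tick) (.branch Option.isSome q₁ q₂)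

/-- Increment a counter. -/
def incr (c : Counter) (q : Statement r N) : Statement r N := .push (.ctr c) (fun _ => ()) q

/-- The program of the translating machine. After reading a one-qubit gate it runs the output
instructions `P false`, after reading a CSIGN gate the instructions `P true`. -/
def program (P : Bool → List (Instr r)) : Label N → Statement r N
  | .header => ifTick (incr .used (incr .used (jump .header))) (jump .main)
  | .main => .pop .inp (fun _ a => a.map .inl)
      (.branch Option.isNone (jump .flush)
        (.branch (fun v => v == some (.inl .one))
          (.push .rev (fun _ => .given) (jump .readOne)) (jump .readFst)))
  | .readOne => ifTick (incr .fst (incr .fst (jump .readOne)))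
      (.branch (fun v => v == some (.inl .sep)) (jump (.run false 0))
        (.push .rev (fun v => match v with
          | some (.inl (.bit b)) => .bit b
          | _ => .sep) (jump .readOne)))
  | .readFst => ifTick (incr .fst (incr .fst (jump .readFst))) (jump .readSnd)
  | .readSnd => ifTick (incr .snd (incr .snd (jump .readSnd))) (jump (.run true 0))
  | .run b p => match (P b)[(p : ℕ)]? with
    | some (.emit s) => .push .rev (fun _ => s) (jump (.run b (Fin.ofNat (N + 1) (p + 1))))
    | some (.copy c) => ifPos c
        (.push .tmp (fun _ => ()) (.push .rev (fun _ => .tick) (jump (.run b p))))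
        (jump (.restore b p))
    | none => jump (.clearFst b)
  | .restore b p => match (P b)[(p : ℕ)]? with
    | some (.copy c) => .pop .tmp (fun _ a => a.map fun _ => .inl .tick)
        (.branch Option.isSome (incr c (jump (.restore b p)))
          (jump (.run b (Fin.ofNat (N + 1) (p + 1)))))
    | _ => .halt
  | .clearFst b => ifPos .fst (jump (.clearFst b)) (jump (.clearSnd b))
  | .clearSnd b => ifPos .snd (jump (.clearSnd b))
      (bif b then incr .used (incr .used (incr .used (incr .used (jump .main)))) else jump .main)
  | .flush => .pop .rev (fun _ a => a.map .inr)
      (.branch Option.isSome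
        (.push .out (fun v => match v with
          | some (.inr s) => s
          | _ => .sep) (jump .flush))
        (.push .out (fun _ => .sep) (jump .pad)))
  | .pad => ifPos .used (.push .out (fun _ => .tick) (jump .pad)) .halt

/-- The contents of the stacks. -/
def contents (I : List QSym) (O R : List (LOSym r)) (n : Counter → ℕ) (t : ℕ) :
    ∀ s : Stack, List (s.Alphabet r)
  | .inp => I
  | .out => O
  | .rev => R
  | .ctr c => List.replicate (n c) ()
  | .tmp => List.replicate t ()

/-- A configuration at a label. -/
def config (l : Label N) (I : List QSym) (O R : List (LOSym r)) (n : Counter → ℕ) (t : ℕ) :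
    TM2.Cfg (Stack.Alphabet r) (Label N) (Register r) :=
  ⟨some l, none, contents I O R n t⟩

variable (I I' : List QSym) (O O' R R' : List (LOSym r)) (n : Counter → ℕ) (t : ℕ)

/-- These lemmas keep the stacks in the normal form `contents I O R n t`, so that executing a
statement is a sequence of rewrites. -/
theorem update_contents_inp :
    Function.update (contents I O R n t) .inp I' = contents I' O R n t := by
  funext s; cases s <;> rfl

theorem update_contents_out :
    Function.update (contents I O R n t) .out O' = contents I O' R n t := by
  funext s; cases s <;> rfl

theorem update_contents_rev :
    Function.update (contents I O R n t) .rev R' = contents I O R' n t := by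
  funext s; cases s <;> rfl

theorem update_contents_ctr (c : Counter) (m : ℕ) :
    Function.update (contents I O R n t) (.ctr c) (List.replicate m ()) =
      contents I O R (Function.update n c m) t := by
  funext s
  cases s with
  | ctr c' =>
    by_cases h : c' = c
    · subst h
      simp [contents]
    · rw [Function.update_of_ne (by simpa using h)]
      simp [contents, h]
  | _ => rfl

theorem update_contents_tmp (m : ℕ) :
    Function.update (contents I O R n t) .tmp (List.replicate m ()) = contents I O R n m := by
  funext s; cases s <;> rfl

variable (P : Bool → List (Instr r))

theorem stepAux_jump (l : Label N) (v : Register r) :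
    TM2.stepAux (jump l) v (contents I O R n t) = config l I O R n t := rfl

theorem stepAux_incr (c : Counter) (q : Statement r N) (v : Register r) :
    TM2.stepAux (incr c q) v (contents I O R n t) =
      TM2.stepAux q v (contents I O R (Function.update n c (n c + 1)) t) := by
  rw [incr, TM2.stepAux, ← update_contents_ctr]
  rfl

theorem stepAux_ifTick_tick (q₁ q₂ : Statement r N) (v : Register r) :
    TM2.stepAux (ifTick q₁ q₂) v (contents (.tick :: I) O R n t) =
      TM2.stepAux q₁ (some (.inl .tick)) (contents I O R n t) := by
  rw [ifTick, TM2.stepAux, ← update_contents_inp (.tick :: I) I]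
  rfl

theorem stepAux_ifTick_of_ne (q₁ q₂ : Statement r N) (v : Register r) {s : QSym} (hs : s ≠ .tick) :
    TM2.stepAux (ifTick q₁ q₂) v (contents (s :: I) O R n t) =
      TM2.stepAux q₂ (some (.inl s)) (contents I O R n t) := by
  rw [ifTick, TM2.stepAux, ← update_contents_inp (s :: I) I]
  cases s <;> first | rfl | exact absurd rfl hs

theorem stepAux_ifPos_succ (c : Counter) (q₁ q₂ : Statement r N) (v : Register r) {m : ℕ}
    (h : n c = m + 1) :
    TM2.stepAux (ifPos c q₁ q₂) v (contents I O R n t) =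
      TM2.stepAux q₁ (some (.inl .tick)) (contents I O R (Function.update n c m) t) := by
  rw [ifPos, TM2.stepAux, ← update_contents_ctr]
  simp [contents, h, List.replicate_succ]

theorem stepAux_ifPos_zero (c : Counter) (q₁ q₂ : Statement r N) (v : Register r) (h : n c = 0) :
    TM2.stepAux (ifPos c q₁ q₂) v (contents I O R n t) =
      TM2.stepAux q₂ none (contents I O R n t) := by
  have e : Function.update n c 0 = n := by rw [← h, Function.update_eq_self]
  conv_rhs => rw [← e, ← update_contents_ctr]
  rw [ifPos, TM2.stepAux]
  simp [contents, h]

/-- The counters with the given values. -/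
def counters (a b c : ℕ) : Counter → ℕ
  | .used => a
  | .fst => b
  | .snd => c

theorem update_counters_used (a b c d : ℕ) :
    Function.update (counters a b c) .used d = counters d b c := by
  funext s; cases s <;> rfl

theorem update_counters_fst (a b c d : ℕ) :
    Function.update (counters a b c) .fst d = counters a d c := by
  funext s; cases s <;> rfl

theorem update_counters_snd (a b c d : ℕ) :
    Function.update (counters a b c) .snd d = counters a b d := by
  funext s; cases s <;> rfl

/-- Counters hold mode numbers, not qubit indices, hence two increments for each tick of the input.
-/
theorem runs_header (k a b c : ℕ) :
    Runs (program (N := N) P) (k + 1)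
      (config .header (List.replicate k .tick ++ .sep :: I) O R (counters a b c) t)
      (config .main I O R (counters (a + 2 * k) b c) t) := by
  induction k generalizing a with
  | zero =>
    refine Runs.single ?_
    simp only [List.replicate_zero, List.nil_append]
    rw [config, TM2.step, program, stepAux_ifTick_of_ne _ _ _ _ _ _ _ _ (by simp), stepAux_jump]
    simp
  | succ k ih =>
    have h := ih (a + 2)
    rw [show a + 2 + 2 * k = a + 2 * (k + 1) by ring] at h
    refine Runs.head ?_ h
    rw [List.replicate_succ, List.cons_append, config, TM2.step, program, stepAux_ifTick_tick,
      stepAux_incr, stepAux_incr, stepAux_jump, update_counters_used, update_counters_used]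
    rfl

end Machine

/-! ### The phases of a run and their cost -/

section Machine

variable {r N : ℕ} {P : Bool → List (Instr r)} (I : List QSym) (O R : List (LOSym r))
  (n : Counter → ℕ) (t : ℕ)

/-- Reading a unary counter empties its stack. Its ticks are therefore moved to `tmp` while they are
written, and `runs_restore` puts them back. -/
theorem runs_copy {b : Bool} {p : Fin (N + 1)} {c : Counter} (hp : (P b)[(p : ℕ)]? = some (.copy c))
    {m : ℕ} (hm : n c = m) :
    Runs (program P) (m + 1) (config (.run b p) I O R n t)
      (config (.restore b p) I O (List.replicate m .tick ++ R) (Function.update n c 0)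
        (t + m)) := by
  induction m generalizing n R t with
  | zero =>
    refine Runs.single ?_
    rw [config, TM2.step, program, hp]
    simp only
    rw [stepAux_ifPos_zero _ _ _ _ _ _ _ _ _ hm, stepAux_jump, ← hm, Function.update_eq_self]
    simp [hm]
  | succ m ih =>
    have h := ih (.tick :: R) (Function.update n c m) (t + 1) (by simp)
    rw [Function.update_idem, show t + 1 + m = t + (m + 1) by ring,
      show List.replicate m LOSym.tick ++ .tick :: R = List.replicate (m + 1) .tick ++ R by
        simp [List.replicate_succ']] at h
    refine Runs.head ?_ h
    rw [config, TM2.step, program, hp]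
    simp only
    rw [stepAux_ifPos_succ _ _ _ _ _ _ _ _ _ hm, TM2.stepAux, TM2.stepAux]
    rw [show (() :: contents I O R (Function.update n c m) t .tmp) = List.replicate (t + 1) () from
      rfl, update_contents_tmp, update_contents_rev, stepAux_jump]
    rfl

theorem runs_restore {b : Bool} {p : Fin (N + 1)} {c : Counter}
    (hp : (P b)[(p : ℕ)]? = some (.copy c)) :
    Runs (program P) (t + 1) (config (.restore b p) I O R n t)
      (config (.run b (Fin.ofNat (N + 1) (p + 1))) I O R (Function.update n c (n c + t)) 0) := by
  induction t generalizing n with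
  | zero =>
    refine Runs.single ?_
    rw [config, TM2.step, program, hp, add_zero, Function.update_eq_self]
    simp only
    rw [TM2.stepAux, show (contents I O R n 0 .tmp).tail = List.replicate 0 () from rfl,
      update_contents_tmp]
    rfl
  | succ t ih =>
    have h := ih (Function.update n c (n c + 1))
    rw [Function.update_idem, Function.update_self, add_assoc, add_comm 1 t] at h
    refine Runs.head ?_ h
    rw [config, TM2.step, program, hp]
    simp only
    rw [TM2.stepAux, show (contents I O R n (t + 1) .tmp).tail = List.replicate t () from rfl,
      update_contents_tmp, TM2.stepAux,
      show ((contents I O R n (t + 1) .tmp).head?.map fun _ => (.inl .tick : QSym ⊕ LOSym r)) =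
        some (.inl .tick) from rfl]
    simp only [Option.isSome_some, cond_true]
    rw [stepAux_incr, stepAux_jump]

theorem runs_instr {b : Bool} {p : Fin (N + 1)} {o : Instr r} (hp : (P b)[(p : ℕ)]? = some o)
    {B : ℕ} (hB : ∀ c, n c ≤ B) :
    Runs (program P) (2 * B + 2) (config (.run b p) I O R n 0)
      (config (.run b (Fin.ofNat (N + 1) (p + 1))) I O ((o.output n).reverse ++ R) n 0) := by
  cases o with
  | emit s =>
    refine (Runs.single ?_).mono (Nat.le_add_left _ _)
    rw [config, TM2.step, program, hp]
    simp only
    rw [TM2.stepAux, update_contents_rev, stepAux_jump]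
    rfl
  | copy c =>
    have h := (runs_copy I O R n 0 hp rfl).trans
      (runs_restore I O (List.replicate (n c) .tick ++ R) (Function.update n c 0) (0 + n c) hp)
    rw [Function.update_idem, Function.update_self, zero_add, zero_add,
      Function.update_eq_self] at h
    simp only [Instr.output, List.reverse_replicate]
    have := hB c
    exact h.mono (by omega)

theorem runs_instrs {b : Bool} (hN : (P b).length ≤ N) {B : ℕ} (hB : ∀ c, n c ≤ B)
    (os pre : List (Instr r)) (h : P b = pre ++ os) :
    Runs (program P) (os.length * (2 * B + 2))
      (config (.run b (Fin.ofNat (N + 1) pre.length)) I O R n 0)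
      (config (.run b (Fin.ofNat (N + 1) (P b).length)) I O
        ((os.flatMap (Instr.output n)).reverse ++ R) n 0) := by
  induction os generalizing pre R with
  | nil =>
    rw [h]
    simpa using Runs.refl _
  | cons o os ih =>
    have hlt : pre.length < (P b).length := by simp [h]
    -- `Fin.ofNat` reduces modulo N + 1. There is no wrap-around, since even the position just past
    -- the last instruction is at most N; there the machine leaves the loop.
    have hval : ((Fin.ofNat (N + 1) pre.length : Fin (N + 1)) : ℕ) = pre.length :=
      Nat.mod_eq_of_lt (by omega)
    have h1 := runs_instr I O R n (P := P) (b := b) (p := Fin.ofNat (N + 1) pre.length) (o := o)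
      (by rw [hval, h]; simp) hB
    rw [hval] at h1
    have h2 := ih ((o.output n).reverse ++ R) (pre ++ [o]) (by simp [h])
    rw [List.length_append, List.length_singleton] at h2
    have h3 := h1.trans h2
    rw [List.flatMap_cons, List.reverse_append, List.append_assoc, List.length_cons]
    exact h3.mono (by ring_nf; rfl)

theorem runs_run {b : Bool} (hN : (P b).length ≤ N) {B : ℕ} (hB : ∀ c, n c ≤ B) :
    Runs (program P) (N * (2 * B + 2) + 1) (config (.run b (0 : Fin (N + 1))) I O R n 0)
      (config (.clearFst b) I O (((P b).flatMap (Instr.output n)).reverse ++ R) n 0) := by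
  refine ((runs_instrs I O R n hN hB (P b) [] rfl).trans (Runs.single ?_)).mono
    (Nat.add_le_add_right (Nat.mul_le_mul_right _ hN) 1)
  have hval : ((Fin.ofNat (N + 1) (P b).length : Fin (N + 1)) : ℕ) = (P b).length :=
    Nat.mod_eq_of_lt (by omega)
  rw [config, TM2.step, program, hval, List.getElem?_eq_none le_rfl]
  rfl

theorem runs_clearSnd (b : Bool) (a s : ℕ) :
    Runs (program (N := N) P) (s + 1) (config (.clearSnd b) I O R (counters a 0 s) t)
      (config .main I O R (counters (a + bif b then 4 else 0) 0 0) t) := by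
  induction s with
  | zero =>
    refine Runs.single ?_
    rw [config, TM2.step, program, stepAux_ifPos_zero _ _ _ _ _ _ _ _ _ rfl]
    cases b
    · rfl
    · simp only [cond_true]
      rw [stepAux_incr, stepAux_incr, stepAux_incr, stepAux_incr, stepAux_jump]
      simp only [update_counters_used]
      rfl
  | succ s ih =>
    refine Runs.head ?_ ih
    rw [config, TM2.step, program, stepAux_ifPos_succ _ _ _ _ _ _ _ _ _ rfl, stepAux_jump,
      update_counters_snd]

theorem runs_clearFst (b : Bool) (a f s : ℕ) :
    Runs (program (N := N) P) (f + s + 2) (config (.clearFst b) I O R (counters a f s) t)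
      (config .main I O R (counters (a + bif b then 4 else 0) 0 0) t) := by
  induction f with
  | zero =>
    refine (Runs.head ?_ (runs_clearSnd I O R t b a s)).mono (by omega)
    rw [config, TM2.step, program, stepAux_ifPos_zero _ _ _ _ _ _ _ _ _ rfl, stepAux_jump]
  | succ f ih =>
    refine (Runs.head ?_ ih).mono (by omega)
    rw [config, TM2.step, program, stepAux_ifPos_succ _ _ _ _ _ _ _ _ _ rfl, stepAux_jump,
      update_counters_fst]

theorem runs_readFst (a f s i : ℕ) :
    Runs (program (N := N) P) (i + 1)
      (config .readFst (List.replicate i .tick ++ .sep :: I) O R (counters a f s) t)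
      (config .readSnd I O R (counters a (f + 2 * i) s) t) := by
  induction i generalizing f with
  | zero =>
    refine Runs.single ?_
    simp only [List.replicate_zero, List.nil_append]
    rw [config, TM2.step, program, stepAux_ifTick_of_ne _ _ _ _ _ _ _ _ (by simp), stepAux_jump]
    simp
  | succ i ih =>
    have h := ih (f + 2)
    rw [show f + 2 + 2 * i = f + 2 * (i + 1) by ring] at h
    refine Runs.head ?_ h
    rw [List.replicate_succ, List.cons_append, config, TM2.step, program, stepAux_ifTick_tick,
      stepAux_incr, stepAux_incr, stepAux_jump, update_counters_fst, update_counters_fst]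
    rfl

theorem runs_readSnd (a f s i : ℕ) :
    Runs (program (N := N) P) (i + 1)
      (config .readSnd (List.replicate i .tick ++ .sep :: I) O R (counters a f s) t)
      (config (.run true 0) I O R (counters a f (s + 2 * i)) t) := by
  induction i generalizing s with
  | zero =>
    refine Runs.single ?_
    simp only [List.replicate_zero, List.nil_append]
    rw [config, TM2.step, program, stepAux_ifTick_of_ne _ _ _ _ _ _ _ _ (by simp), stepAux_jump]
    simp
  | succ i ih =>
    have h := ih (s + 2)
    rw [show s + 2 + 2 * i = s + 2 * (i + 1) by ring] at h
    refine Runs.head ?_ h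
    rw [List.replicate_succ, List.cons_append, config, TM2.step, program, stepAux_ifTick_tick,
      stepAux_incr, stepAux_incr, stepAux_jump, update_counters_snd, update_counters_snd]
    rfl

theorem runs_readOne_ticks (a f s i : ℕ) :
    Runs (program (N := N) P) (i + 1)
      (config .readOne (List.replicate i .tick ++ .sep :: I) O R (counters a f s) t)
      (config (.run false 0) I O R (counters a (f + 2 * i) s) t) := by
  induction i generalizing f with
  | zero =>
    refine Runs.single ?_
    simp only [List.replicate_zero, List.nil_append]
    rw [config, TM2.step, program, stepAux_ifTick_of_ne _ _ _ _ _ _ _ _ (by simp)]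
    rfl
  | succ i ih =>
    have h := ih (f + 2)
    rw [show f + 2 + 2 * i = f + 2 * (i + 1) by ring] at h
    refine Runs.head ?_ h
    rw [List.replicate_succ, List.cons_append, config, TM2.step, program, stepAux_ifTick_tick,
      stepAux_incr, stepAux_incr, stepAux_jump, update_counters_fst, update_counters_fst]
    rfl

/-- The bits of the description go to the output while they are read, so an input description of any
length needs no storage of its own. -/
theorem runs_readOne (a f s i : ℕ) (d : List Bool) :
    Runs (program (N := N) P) (d.length + (i + 1))
      (config .readOne (d.map .bit ++ (List.replicate i .tick ++ .sep :: I)) O R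
        (counters a f s) t)
      (config (.run false 0) I O ((d.map .bit).reverse ++ R) (counters a (f + 2 * i) s) t) := by
  induction d generalizing R with
  | nil => simpa using runs_readOne_ticks I O R t a f s i
  | cons x d ih =>
    have h := ih (.bit x :: R)
    rw [show (d.map LOSym.bit).reverse ++ .bit x :: R = ((x :: d).map .bit).reverse ++ R by
      simp] at h
    refine (Runs.head ?_ h).mono (by simp; try omega)
    rw [List.map_cons, List.cons_append, config, config, TM2.step, program,
      stepAux_ifTick_of_ne _ _ _ _ _ _ _ _ (by simp), ← update_contents_rev _ _ R (.bit x :: R)]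
    rfl

/-- Gates were collected in reverse, and popping them onto the output stack restores the order. The
header comes last because it ends up on top, and because the number of modes is known only after all
gates have been read. -/
theorem runs_flush (n : Counter → ℕ) :
    Runs (program (N := N) P) (R.length + 1) (config .flush I O R n t)
      (config .pad I (.sep :: (R.reverse ++ O)) [] n t) := by
  induction R generalizing O with
  | nil =>
    refine Runs.single ?_
    rw [config, TM2.step, program, TM2.stepAux, update_contents_rev, TM2.stepAux]
    simp only [contents, List.head?_nil, Option.map_none, Option.isSome_none, cond_false]
    rw [TM2.stepAux, update_contents_out]
    rfl
  | cons x R ih =>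
    have h := ih (x :: O)
    rw [show R.reverse ++ x :: O = (x :: R).reverse ++ O by simp] at h
    refine Runs.head ?_ h
    rw [config, TM2.step, program, TM2.stepAux, update_contents_rev, TM2.stepAux]
    simp only [contents, List.head?_cons, Option.map_some, Option.isSome_some, cond_true]
    rw [TM2.stepAux, update_contents_out]
    rfl

theorem runs_pad (a : ℕ) :
    Runs (program (N := N) P) (a + 1) (config .pad I O R (counters a 0 0) t)
      ⟨none, none, contents I (List.replicate a .tick ++ O) R (counters 0 0 0) t⟩ := by
  induction a generalizing O with
  | zero =>
    refine Runs.single ?_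
    rw [config, TM2.step, program, stepAux_ifPos_zero _ _ _ _ _ _ _ _ _ rfl]
    rfl
  | succ a ih =>
    have h := ih (.tick :: O)
    rw [show List.replicate a LOSym.tick ++ .tick :: O = List.replicate (a + 1) .tick ++ O by
      simp [List.replicate_succ']] at h
    refine Runs.head ?_ h
    rw [config, TM2.step, program, stepAux_ifPos_succ _ _ _ _ _ _ _ _ _ rfl, TM2.stepAux,
      update_contents_out, stepAux_jump, update_counters_used]
    rfl

/-- The string that the machine writes for a gate, when `a` modes are in use. -/
def gateOutput (P : Bool → List (Instr r)) (a : ℕ) {k : ℕ} : QGate (List Bool) k → List (LOSym r)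
  | .one d i => .given :: d.map .bit ++ (P false).flatMap (Instr.output (counters a (2 * i) 0))
  | .csign i j _ => (P true).flatMap (Instr.output (counters a (2 * i) (2 * j)))

/-- The string that the machine writes for a list of gates, when `a` modes are in use. -/
def gatesOutput (P : Bool → List (Instr r)) {k : ℕ} : ℕ → List (QGate (List Bool) k) →
    List (LOSym r)
  | _, [] => []
  | a, .one d i :: gs => gateOutput P a (.one d i) ++ gatesOutput P a gs
  | a, .csign i j h :: gs => gateOutput P a (.csign i j h) ++ gatesOutput P (a + 4) gs

theorem step_main_one :
    TM2.step (program (N := N) P) (config .main (.one :: I) O R n t) =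
      some (config .readOne I O (.given :: R) n t) := by
  rw [config, config, TM2.step, program, TM2.stepAux, update_contents_inp, TM2.stepAux, TM2.stepAux,
    ← update_contents_rev _ _ R (.given :: R)]
  rfl

theorem step_main_csign :
    TM2.step (program (N := N) P) (config .main (.csign :: I) O R n t) =
      some (config .readFst I O R n t) := by
  rw [config, TM2.step, program, TM2.stepAux, update_contents_inp, TM2.stepAux, TM2.stepAux]
  rfl

theorem step_main_nil :
    TM2.step (program (N := N) P) (config .main [] O R n t) =
      some (config .flush [] O R n t) := by
  rw [config, TM2.step, program, TM2.stepAux, update_contents_inp, TM2.stepAux, TM2.stepAux]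
  rfl

variable {k : ℕ}

theorem runs_main_one (hN : (P false).length ≤ N) {a B : ℕ} (d : List Bool) (i : Fin k)
    (ha : a ≤ B) (hi : 2 * (i : ℕ) ≤ B) :
    Runs (program (N := N) P) ((QGate.one d i).encode.length + N * (2 * B + 2) + 2 * B + 3)
      (config .main ((QGate.one d i).encode ++ I) O R (counters a 0 0) 0)
      (config .main I O ((gateOutput P a (.one d i)).reverse ++ R) (counters a 0 0) 0) := by
  have hB : ∀ c, counters a (2 * i) 0 c ≤ B := by
    rintro (_ | _ | _) <;> simp [counters, ha, hi]
  have h1 := Runs.single (step_main_one (N := N) (P := P)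
    (d.map .bit ++ (List.replicate i .tick ++ .sep :: I)) O R (counters a 0 0) 0)
  have h2 := runs_readOne (N := N) (P := P) I O (.given :: R) 0 a 0 0 i d
  have h3 := runs_run I O ((d.map .bit).reverse ++ .given :: R) (counters a (2 * i) 0) hN hB
  have h4 := runs_clearFst (N := N) (P := P) I O (((P false).flatMap (Instr.output
    (counters a (2 * i) 0))).reverse ++ ((d.map .bit).reverse ++ .given :: R)) 0 false a (2 * i) 0
  rw [zero_add] at h2
  have h := ((h1.trans h2).trans h3).trans h4
  simp only [QGate.encode, gateOutput, List.reverse_append, List.reverse_cons, List.append_assoc,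
    List.cons_append, List.nil_append, List.length_append, List.length_map, List.length_cons,
    List.length_replicate, List.length_nil] at h ⊢
  exact h.mono (by omega)

theorem runs_main_csign (hN : (P true).length ≤ N) {a B : ℕ} (i j : Fin k) (hij : i ≠ j)
    (ha : a ≤ B) (hi : 2 * (i : ℕ) ≤ B) (hj : 2 * (j : ℕ) ≤ B) :
    Runs (program (N := N) P)
      ((QGate.csign (A := List Bool) i j hij).encode.length + N * (2 * B + 2) + 2 * B + 3)
      (config .main ((QGate.csign i j hij).encode ++ I) O R (counters a 0 0) 0)
      (config .main I O ((gateOutput P a (.csign i j hij)).reverse ++ R)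
        (counters (a + 4) 0 0) 0) := by
  have hB : ∀ c, counters a (2 * i) (2 * j) c ≤ B := by
    rintro (_ | _ | _) <;> simp [counters, ha, hi, hj]
  have h1 := Runs.single (step_main_csign (N := N) (P := P)
    (List.replicate i .tick ++ .sep :: (List.replicate j .tick ++ .sep :: I)) O R
    (counters a 0 0) 0)
  have h2 := runs_readFst (N := N) (P := P) (List.replicate j .tick ++ .sep :: I) O R 0 a 0 0 i
  have h3 := runs_readSnd (N := N) (P := P) I O R 0 a (0 + 2 * i) 0 j
  rw [zero_add] at h2 h3
  rw [zero_add] at h3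
  have h4 := runs_run I O R (counters a (2 * i) (2 * j)) hN hB
  have h5 := runs_clearFst (N := N) (P := P) I O (((P true).flatMap (Instr.output
    (counters a (2 * i) (2 * j)))).reverse ++ R) 0 true a (2 * i) (2 * j)
  have h := (((h1.trans h2).trans h3).trans h4).trans h5
  simp only [QGate.encode, gateOutput, List.append_assoc,
    List.cons_append, List.nil_append, List.length_append, List.length_cons,
    List.length_replicate, List.length_nil, cond_true] at h ⊢
  exact h.mono (by omega)

/-- Translation of a list of gates, all counters being bounded by `B`. -/
theorem runs_gates (hN : ∀ b, (P b).length ≤ N) {B : ℕ} (hk : 2 * k ≤ B)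
    (gs : List (QGate (List Bool) k)) {a : ℕ} (ha : a + 4 * csignCount gs ≤ B) :
    Runs (program (N := N) P)
      ((gs.flatMap QGate.encode).length + gs.length * (N * (2 * B + 2) + 4 * B + 3))
      (config .main (gs.flatMap QGate.encode) O R (counters a 0 0) 0)
      (config .main [] O ((gatesOutput P a gs).reverse ++ R)
        (counters (a + 4 * csignCount gs) 0 0) 0) := by
  induction gs generalizing a R with
  | nil => simpa [csignCount, gatesOutput] using Runs.refl _
  | cons q gs ih =>
    cases q with
    | one d i =>
      have hi := i.isLt
      rw [csignCount] at ha ⊢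
      have h1 := runs_main_one (gs.flatMap QGate.encode) O R (hN false) d i
        (show a ≤ B by omega) (by omega)
      have h := h1.trans (ih _ ha)
      rw [List.flatMap_cons, gatesOutput, List.reverse_append, List.append_assoc,
        List.length_append, List.length_cons, add_mul]
      exact h.mono (by omega)
    | csign i j hij =>
      have hi := i.isLt
      have hj := j.isLt
      rw [csignCount] at ha ⊢
      have h1 := runs_main_csign (gs.flatMap QGate.encode) O R (hN true) i j hij
        (show a ≤ B by omega) (by omega) (by omega)
      have h := h1.trans (ih _ (a := a + 4) (by omega))
      rw [show a + 4 + 4 * csignCount gs = a + 4 * (csignCount gs + 1) by ring] at h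
      rw [List.flatMap_cons, gatesOutput, List.reverse_append, List.append_assoc,
        List.length_append, List.length_cons, add_mul]
      exact h.mono (by omega)

theorem length_instr_output (o : Instr r) {n : Counter → ℕ} {B : ℕ} (hB : ∀ c, n c ≤ B) :
    (o.output n).length ≤ B + 1 := by
  cases o with
  | emit s => simp [Instr.output]
  | copy c => simpa [Instr.output] using (hB c).trans (Nat.le_succ B)

theorem length_flatMap_output (os : List (Instr r)) {n : Counter → ℕ} {B : ℕ}
    (hB : ∀ c, n c ≤ B) : (os.flatMap (Instr.output n)).length ≤ os.length * (B + 1) := by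
  induction os with
  | nil => simp
  | cons o os ih =>
    have := length_instr_output o hB
    rw [List.flatMap_cons, List.length_append, List.length_cons, add_mul]
    omega

/-- Flushing takes one step per output symbol, so the running time needs a bound on the length of
the output. -/
theorem length_gatesOutput (hN : ∀ b, (P b).length ≤ N) {B : ℕ} (hk : 2 * k ≤ B)
    (gs : List (QGate (List Bool) k)) {a : ℕ} (ha : a + 4 * csignCount gs ≤ B) :
    (gatesOutput P a gs).length ≤
      (gs.flatMap QGate.encode).length + gs.length * (N * (B + 1)) := by
  induction gs generalizing a with
  | nil => simp [gatesOutput]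
  | cons q gs ih =>
    cases q with
    | one d i =>
      have hi := i.isLt
      rw [csignCount] at ha
      have h1 := length_flatMap_output (P false) (n := counters a (2 * i) 0) (B := B)
        (by rintro (_ | _ | _) <;> simp [counters] <;> omega)
      have h2 := Nat.mul_le_mul_right (B + 1) (hN false)
      have h3 := ih ha
      simp only [gatesOutput, gateOutput, QGate.encode, List.flatMap_cons, List.length_append,
        List.length_cons, List.length_map, List.length_replicate, add_mul, one_mul] at h3 ⊢
      omega
    | csign i j hij =>
      have hi := i.isLt
      have hj := j.isLt
      rw [csignCount] at ha
      have h1 := length_flatMap_output (P true) (n := counters a (2 * i) (2 * j)) (B := B)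
        (by rintro (_ | _ | _) <;> simp [counters] <;> omega)
      have h2 := Nat.mul_le_mul_right (B + 1) (hN true)
      have h3 := ih (a := a + 4) (by omega)
      simp only [gatesOutput, gateOutput, QGate.encode, List.flatMap_cons, List.length_append,
        List.length_cons, List.length_replicate, add_mul, one_mul] at h3 ⊢
      omega

theorem csignCount_le (gs : List (QGate (List Bool) k)) : csignCount gs ≤ gs.length := by
  induction gs with
  | nil => simp [csignCount]
  | cons q gs ih => cases q <;> simp [csignCount] <;> omega

theorem length_le_length_encode (gs : List (QGate (List Bool) k)) :
    gs.length ≤ (gs.flatMap QGate.encode).length := by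
  induction gs with
  | nil => simp
  | cons q gs ih =>
    cases q <;> simp only [List.flatMap_cons, List.length_append, List.length_cons, QGate.encode,
      List.length_nil] <;> omega

/-- The machine writes its output string in quadratic time. -/
theorem runs_program (hN : ∀ b, (P b).length ≤ N) (Q : QCircuit (List Bool)) :
    Runs (program (N := N) P)
      (Q.encode.length * (N * (18 * Q.encode.length + 3) + 24 * Q.encode.length + 3) +
        14 * Q.encode.length + 6)
      (config .header Q.encode [] [] (counters 0 0 0) 0)
      ⟨none, none, contents [] (List.replicate (2 * (Q.qubits + 2 * Q.numCSIGN)) .tick ++ [.sep] ++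
        gatesOutput P (2 * Q.qubits) Q.gates) [] (counters 0 0 0) 0⟩ := by
  have hlen : Q.encode.length = Q.qubits + 1 + (Q.gates.flatMap QGate.encode).length := by
    simp [QCircuit.encode]
    omega
  have hg := length_le_length_encode Q.gates
  have hc := csignCount_le Q.gates
  have henc : Q.encode = List.replicate Q.qubits .tick ++ .sep :: Q.gates.flatMap QGate.encode := by
    simp [QCircuit.encode]
  -- This common bound on the counters holds because the input has a symbol for each qubit and at
  -- least one for each gate.
  have hB : 2 * Q.qubits + 4 * csignCount Q.gates ≤ 6 * Q.encode.length := by omega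
  have hk : 2 * Q.qubits ≤ 6 * Q.encode.length := by omega
  have h1 := runs_header (N := N) (Q.gates.flatMap QGate.encode) ([] : List (LOSym r)) [] 0 P
    Q.qubits 0 0 0
  rw [← henc, zero_add] at h1
  have h2 := runs_gates (N := N) (P := P) ([] : List (LOSym r)) [] hN hk Q.gates hB
  have h3 := Runs.single (step_main_nil (N := N) (P := P) ([] : List (LOSym r))
    ((gatesOutput P (2 * Q.qubits) Q.gates).reverse ++ [])
    (counters (2 * Q.qubits + 4 * csignCount Q.gates) 0 0) 0)
  have h4 := runs_flush (N := N) (P := P) [] ([] : List (LOSym r))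
    ((gatesOutput P (2 * Q.qubits) Q.gates).reverse ++ []) 0
    (counters (2 * Q.qubits + 4 * csignCount Q.gates) 0 0)
  have h5 := runs_pad (N := N) (P := P) []
    (.sep :: (((gatesOutput P (2 * Q.qubits) Q.gates).reverse ++ []).reverse ++ [])) [] 0
    (2 * Q.qubits + 4 * csignCount Q.gates)
  have h := (((h1.trans h2).trans h3).trans h4).trans h5
  have hout := length_gatesOutput hN hk Q.gates hB
  rw [show 2 * Q.qubits + 4 * csignCount Q.gates = 2 * (Q.qubits + 2 * Q.numCSIGN) by
    rw [QCircuit.numCSIGN]; ring] at h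
  simp only [List.append_nil, List.reverse_reverse, List.length_reverse] at h
  rw [List.append_assoc, List.singleton_append]
  refine h.mono ?_
  have hΓ : Q.numCSIGN = csignCount Q.gates := rfl
  have hgl : Q.gates.length ≤ Q.encode.length := by omega
  have e1 := Nat.mul_le_mul_right
    (N * (2 * (6 * Q.encode.length) + 2) + 4 * (6 * Q.encode.length) + 3) hgl
  have e2 := Nat.mul_le_mul_right (N * (6 * Q.encode.length + 1)) hgl
  -- With L the input length and B = 6L, running the instructions of a gate contributes N(12L + 2)
  -- and flushing them N(6L + 1), together N(18L + 3).
  have e3 : Q.encode.length * (N * (18 * Q.encode.length + 3) + 24 * Q.encode.length + 3) =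
    Q.encode.length * (N * (2 * (6 * Q.encode.length) + 2) + 4 * (6 * Q.encode.length) + 3) +
      Q.encode.length * (N * (6 * Q.encode.length + 1)) := by ring
  rw [e3]
  omega

end Machine

/-! ### The output instructions and the finished machine -/

section Instructions

variable {r : ℕ}

/-- The instructions that write a gate on the modes `n a.1 + a.2` and `n b.1 + b.2`. -/
def gateInstrs (s : LOSym r) (a b : Counter × ℕ) : List (Instr r) :=
  [.emit s, .copy a.1] ++ List.replicate a.2 (.emit .tick) ++ [.emit .sep, .copy b.1] ++
    List.replicate b.2 (.emit .tick) ++ [.emit .sep]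

theorem flatMap_output_replicate_tick (n : Counter → ℕ) (m : ℕ) :
    (List.replicate m (.emit .tick)).flatMap (Instr.output (r := r) n) =
      List.replicate m .tick := by
  induction m with
  | zero => rfl
  | succ m ih => rw [List.replicate_succ, List.flatMap_cons, ih]; rfl

theorem flatMap_output_gateInstrs (n : Counter → ℕ) (s : LOSym r) (a b : Counter × ℕ) :
    (gateInstrs s a b).flatMap (Instr.output n) =
      s :: List.replicate (n a.1 + a.2) .tick ++ [.sep] ++ List.replicate (n b.1 + b.2) .tick ++
        [.sep] := by
  rw [List.replicate_add, List.replicate_add]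
  simp [gateInstrs, List.flatMap_append, flatMap_output_replicate_tick, Instr.output,
    -List.replicate_append_replicate]

variable (w : List (LOGate (Matrix.unitaryGroup (Fin 2) ℂ) 3))

/-- The instructions that write the gates `w` on the modes `n (e s).1 + (e s).2`. -/
def placeInstrs (e : Fin 3 → Counter × ℕ) : List (Instr w.length) :=
  (List.finRange w.length).flatMap fun t =>
    gateInstrs (.fixed t) (e (w.get t).fst) (e (w.get t).snd)

theorem flatMap_output_placeInstrs (n : Counter → ℕ) (e : Fin 3 → Counter × ℕ) {m : ℕ}
    (f : Fin 3 ↪ Fin m) (hf : ∀ s, (f s : ℕ) = n (e s).1 + (e s).2) :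
    (placeInstrs w e).flatMap (Instr.output n) = (placeW w f).flatMap LOGate.encode := by
  rw [placeInstrs, placeW, List.ofFn_eq_map, List.flatMap_map, List.flatMap_assoc]
  congr 1
  funext t
  rw [flatMap_output_gateInstrs]
  simp [LOGate.encode, LOLabel.encode, hf]

/-- The output instructions of the translating machine. -/
def translationInstrs : Bool → List (Instr w.length)
  -- The label and the description have been written during reading. Counter `fst` holds 2i, so
  -- these are the modes 2i + 1 and 2i.
  | false => [.copy .fst, .emit .tick, .emit .sep, .copy .fst, .emit .sep]
  | true => gateInstrs .hadamard (.fst, 0) (.snd, 0) ++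
      placeInstrs w ![(.fst, 0), (.used, 0), (.used, 1)] ++
      placeInstrs w ![(.snd, 0), (.used, 2), (.used, 3)] ++
      gateInstrs .hadamard (.fst, 0) (.snd, 0)

/-- After g CSIGN gates the counter `used` stands at 2k + 4g, the first fresh ancilla mode, which is
the number that `translateGates` uses. -/
theorem gatesOutput_translationInstrs {k n : ℕ} (g : ℕ) (gs : List (QGate (List Bool) k))
    (h : k + 2 * (g + csignCount gs) ≤ n) :
    gatesOutput (translationInstrs w) (2 * k + 4 * g) gs =
      (translateGates w n g gs h).flatMap LOGate.encode := by
  induction gs generalizing g with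
  | nil => rfl
  | cons q gs ih =>
    cases q with
    | one d i =>
      rw [gatesOutput, translateGates, List.flatMap_cons, ih g h]
      congr 1
      simp [gateOutput, translationInstrs, Instr.output, counters, LOGate.encode, LOLabel.encode,
        List.replicate_succ']
    | csign i j hij =>
      have hi := i.isLt
      have hj := j.isLt
      have hne : (i : ℕ) ≠ j := fun e => hij (Fin.ext e)
      rw [csignCount] at h
      rw [gatesOutput, translateGates, List.flatMap_append, List.flatMap_append,
        List.flatMap_append, List.flatMap_append,
        show 2 * k + 4 * g + 4 = 2 * k + 4 * (g + 1) by ring, ih (g + 1) (by omega)]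
      congr 1
      rw [gateOutput, translationInstrs, List.flatMap_append, List.flatMap_append,
        List.flatMap_append, flatMap_output_gateInstrs,
        flatMap_output_placeInstrs w _ _ (threeModes (⟨2 * i, by omega⟩ : Fin (2 * n))
          ⟨2 * k + 4 * g, by omega⟩ ⟨2 * k + 4 * g + 1, by omega⟩ (by simp; omega) (by simp; omega)
          (by simp)) (fun s => by fin_cases s <;> rfl),
        flatMap_output_placeInstrs w _ _ (threeModes (⟨2 * j, by omega⟩ : Fin (2 * n))
          ⟨2 * k + 4 * g + 2, by omega⟩ ⟨2 * k + 4 * g + 3, by omega⟩ (by simp; omega)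
          (by simp; omega) (by simp)) (fun s => by fin_cases s <;> rfl)]
      simp [counters, LOGate.encode, LOLabel.encode]

/-- The translating machine. -/
def translator : FinTM2 where
  K := Stack
  k₀ := .inp
  k₁ := .out
  Γ := Stack.Alphabet w.length
  Λ := Label (max (translationInstrs w false).length (translationInstrs w true).length)
  main := .header
  σ := Register w.length
  initialState := none
  m := program (translationInstrs w)

theorem initList_translator (l : List QSym) :
    initList (translator w) l = config .header l [] [] (counters 0 0 0) 0 := by
  simp only [initList, config]
  congr 1
  funext s
  cases s with
  | ctr c => cases c <;> rfl
  | _ => rfl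

theorem haltList_translator (l : List (LOSym w.length)) :
    haltList (translator w) l = ⟨none, none, contents [] l [] (counters 0 0 0) 0⟩ := by
  simp only [haltList]
  congr 1
  funext s
  cases s with
  | ctr c => cases c <;> rfl
  | _ => rfl

/-- The translation is computed in quadratic time. -/
theorem translate_computableInPolyTime :
    Nonempty (TM2ComputableInPolyTime QCircuit.encode LOCircuit.encode (translate w)) := by
  set N := max (translationInstrs w false).length (translationInstrs w true).length with hN
  have hP : ∀ b, (translationInstrs w b).length ≤ N := by
    rintro (_ | _)
    · exact le_max_left _ _
    · exact le_max_right _ _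
  have hruns := fun Q => runs_program hP Q
  -- The computability structure takes the exact number of steps as data, while `Runs` only asserts
  -- its existence.
  choose s hs hs' using hruns
  refine ⟨{
    tm := translator w
    inputAlphabet := Equiv.refl _
    outputAlphabet := Equiv.refl _
    time := Polynomial.X * (Polynomial.C N * (18 * Polynomial.X + 3) + 24 * Polynomial.X + 3) +
      14 * Polynomial.X + 6
    outputsFun := fun Q => ⟨⟨s Q, ?_⟩, ?_⟩ }⟩
  · have hinit : initList (translator w) (Q.encode.map (Equiv.refl QSym).invFun) =
        config .header Q.encode [] [] (counters 0 0 0) 0 :=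
      (congrArg (initList (translator w)) (List.map_id _)).trans (initList_translator w _)
    have hfinal : haltList (translator w)
        ((translate w Q).encode.map (Equiv.refl (LOSym w.length)).invFun) =
        ⟨none, none, contents [] (translate w Q).encode [] (counters 0 0 0) 0⟩ :=
      (congrArg (haltList (translator w)) (List.map_id _)).trans (haltList_translator w _)
    have hout : (translate w Q).encode =
        List.replicate (2 * (Q.qubits + 2 * Q.numCSIGN)) .tick ++ [.sep] ++
          gatesOutput (translationInstrs w) (2 * Q.qubits) Q.gates := by
      rw [LOCircuit.encode]
      congr 1
      exact (gatesOutput_translationInstrs w 0 Q.gates _).symm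
    refine Eq.trans ?_ ((hs' Q).trans ?_)
    · exact congrArg (fun c => (flip bind (translator w).step)^[s Q] (some c)) hinit
    · rw [← hout]
      exact congrArg some hfinal.symm
  · refine (hs Q).trans (le_of_eq ?_)
    simp

end Instructions

end KLM

end

/-! ### Assembly of the theorem -/

theorem theorem2 :
    -- `W` is unitary
    KLM.W ∈ Matrix.unitaryGroup (Fin 3) ℂ ∧
    -- `W` on mode `i` and on ancilla modes `j`, `k` that start in `|0,1⟩` and are postselected on
    -- `|0,1⟩` applies `NS₁` to mode `i`, with amplitude `1/2`
    (∀ (m n : ℕ) (i j k : Fin m), Function.Injective ![i, j, k] → ∀ S T : KLM.Occ m n,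
      T.1 i ≤ 2 → T.1 j = 0 → T.1 k = 1 → S.1 j = 0 → S.1 k = 1 →
      KLM.fock n (KLM.onModes ![i, j, k] KLM.W) S T =
        if S = T then 1 / 2 * KLM.ns₁ (T.1 i) else 0) ∧
    -- Hadamard, two `NS₁` gadgets and Hadamard apply CSIGN to the modes `p`, `q`, with
    -- amplitude `1/4`
    (∀ (m n : ℕ) (p q a b c d : Fin m), Function.Injective ![p, q, a, b, c, d] →
      ∀ S T : KLM.Occ m n, T.1 p ≤ 1 → T.1 q ≤ 1 →
      T.1 a = 0 → T.1 b = 1 → T.1 c = 0 → T.1 d = 1 →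
      S.1 a = 0 → S.1 b = 1 → S.1 c = 0 → S.1 d = 1 →
      KLM.fock n (KLM.onModes ![p, q] (KLM.hadamard : Matrix (Fin 2) (Fin 2) ℂ) *
          KLM.onModes ![q, c, d] KLM.W * KLM.onModes ![p, a, b] KLM.W *
          KLM.onModes ![p, q] (KLM.hadamard : Matrix (Fin 2) (Fin 2) ℂ)) S T =
        if S = T then 1 / 4 * (if T.1 p = 1 ∧ T.1 q = 1 then -1 else 1) else 0) ∧
    -- for some fixed sequence `w` of two-mode gates with product `W`:
    ∃ w : List (KLM.LOGate (Matrix.unitaryGroup (Fin 2) ℂ) 3),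
      KLM.loMatrix id w = KLM.W ∧
      -- the translation is computed by a Turing machine in polynomial time
      Nonempty (Turing.TM2ComputableInPolyTime KLM.QCircuit.encode KLM.LOCircuit.encode
        (KLM.translate w)) ∧
      -- and it is correct, whatever unitaries the gate descriptions stand for
      ∀ (ρ : List Bool → Matrix.unitaryGroup (Fin 2) ℂ) (Q : KLM.QCircuit (List Bool)),
        KLM.fock (KLM.translate w Q).photons
            ((KLM.translate w Q).matrix (KLM.LOLabel.unitary w ρ))
            (KLM.stdState (KLM.translate w Q).photons)
            (KLM.stdState (KLM.translate w Q).photons) =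
          Q.matrix ρ (fun _ => 0) (fun _ => 0) / 4 ^ Q.numCSIGN ∧
        -- every dual-rail encoded input is mapped to the encoded output state when the ancilla
        -- modes are postselected on their initial state
        ∀ (x : Fin Q.qubits → Fin 2) (S : KLM.Occ (2 * (Q.qubits + 2 * Q.numCSIGN))
            (Q.qubits + 2 * Q.numCSIGN)),
          (∀ p : Fin (2 * (Q.qubits + 2 * Q.numCSIGN)), 2 * Q.qubits ≤ (p : ℕ) → S.1 p = (p : ℕ) % 2) →
          KLM.fock (Q.qubits + 2 * Q.numCSIGN)
              ((KLM.translate w Q).matrix (KLM.LOLabel.unitary w ρ))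
              S (KLM.dualRail (2 * Q.numCSIGN) x) =
            ∑ y : Fin Q.qubits → Fin 2, if S = KLM.dualRail (2 * Q.numCSIGN) y
              then Q.matrix ρ y x / 4 ^ Q.numCSIGN else 0 := by
  obtain ⟨w, hw⟩ := KLM.exists_loMatrix_eq KLM.W_mem_unitaryGroup
  exact ⟨KLM.W_mem_unitaryGroup,
    fun m n i j k he S T hi hj hk hj' hk' => KLM.fock_onModes_W he hi hj hk hj' hk',
    fun m n p q a b c d he S T hp hq ha hb hc hd ha' hb' hc' hd' =>
      KLM.fock_csignGadget he hp hq ha hb hc hd ha' hb' hc' hd',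
    w, hw, KLM.translate_computableInPolyTime w, fun ρ Q =>
      ⟨KLM.fock_translate_stdState hw ρ Q, fun x S hS => KLM.fock_translate hw ρ Q x S hS⟩⟩
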